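/- Let $A:\mathbb R\to\mathbb R$ be positive and smooth, and suppose that $A$ extends analytically to $$D_0=\{x\in\mathbb C:\ |\operatorname{Im}x|<\max(\rho_0,(\tan\theta_0)|\operatorname{Re}x|)\}$$ for some $\rho_0>0$ and $0<\theta_0<\pi/2$, and that for some $\tau>0$ one has $A(x)=\mathcal O(|x|^{-1-\tau})$ as $x\to\infty$ in $D_0$. For $\epsilon>0$ let $$L=\begin{bmatrix}-\frac{\epsilon}{i}\frac{d}{dx}&-iA(x)\\-iA(x)&\frac{\epsilon}{i}\frac{d}{dx}\end{bmatrix}.$$ For real $\lambda\neq0$ let $\mathbf f^r_\pm$ (resp. $\mathbf f^l_\pm$) be the Jost solutions: the holomorphic solutions on $D_0$ of $L\mathbf f=\lambda\mathbf f$ such that $$\mathbf f_+=e^{i\lambda x/\epsilon}\left(\begin{bmatrix}0\\1\end{bmatrix}+o(1)\right),\qquad \mathbf f_-=e^{-i\lambda x/\epsilon}\left(\begin{bmatrix}1\\0\end{bmatrix}+o(1)\right)$$ as $\operatorname{Re}x\to+\infty$ (resp. $\operatorname{Re}x\to-\infty$) in $D_0$. Let $T(\lambda,\epsilon)$ be the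 constant $2\times2$ matrix with $(\mathbf f^l_+,\mathbf f^l_-)=(\mathbf f^r_+,\mathbf f^r_-)\,T$, let $(a,b)^{\mathsf T}$ be its first column, and let $R(\lambda,\epsilon)=b(\lambda,\epsilon)/a(\lambda,\epsilon)$ be the reflection coefficient. Then for every $\epsilon>0$ and every real $\lambda\ne0$ the matrix $T(\lambda,\epsilon)$ exists and is unique. Moreover, for every $\delta>0$ there exist $\sigma>0$, $C$ and $\epsilon_0>0$, independent of $\epsilon$ and $\lambda$, such that for all $0<\epsilon<\epsilon_0$ and all real $\lambda$ with $|\lambda|\ge\delta$ one has $a(\lambda,\epsilon)\neq0$ and $$|R(\lambda,\epsilon)|\le C\,e^{-\sigma/\epsilon}.$$ -/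

import Mathlib

open Filter Topology

noncomputable section

/-- The domain `D(ρ₀, θ₀)`: a horizontal strip together with the two sectors about the real axis. -/
def sectorDomain (ρ₀ θ₀ : ℝ) : Set ℂ :=
  {x : ℂ | |x.im| < max ρ₀ (Real.tan θ₀ * |x.re|)}

/-- Assumption (A1) on the potential `A`; `Aext` is the analytic extension of `A`
to `D(ρ₀, θ₀)`. -/
structure AssumptionA1 (A : ℝ → ℝ) (Aext : ℂ → ℂ) (ρ₀ θ₀ : ℝ) : Prop where
  rho_pos : 0 < ρ₀
  theta_pos : 0 < θ₀
  theta_lt : θ₀ < Real.pi / 2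
  pos : ∀ x : ℝ, 0 < A x
  smooth : ContDiff ℝ (⊤ : ℕ∞) A
  extends_real : ∀ x : ℝ, Aext (x : ℂ) = (A x : ℂ)
  analytic : AnalyticOnNhd ℂ Aext (sectorDomain ρ₀ θ₀)
  decay : ∃ τ : ℝ, 0 < τ ∧
    Aext =O[Bornology.cobounded ℂ ⊓ 𝓟 (sectorDomain ρ₀ θ₀)]
      (fun x : ℂ => ‖x‖ ^ (-1 - τ))

/-- The Dirac operator
`L = [[-(ε/i) d/dx, -i A(x)], [-i A(x), (ε/i) d/dx]]`, acting on functions of a complex variable. -/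
def diracOp (A : ℂ → ℂ) (ε : ℝ) (f : ℂ → Fin 2 → ℂ) (x : ℂ) : Fin 2 → ℂ :=
  ![-((ε : ℂ) / Complex.I) * deriv (fun y => f y 0) x + (-Complex.I * A x) * f x 1,
    (-Complex.I * A x) * f x 0 + ((ε : ℂ) / Complex.I) * deriv (fun y => f y 1) x]

/-- `f` is a holomorphic solution of `L f = lam f` on `D`. -/
def IsDiracSolution (A : ℂ → ℂ) (D : Set ℂ) (ε lam : ℝ) (f : ℂ → Fin 2 → ℂ) : Prop :=
  DifferentiableOn ℂ f D ∧ ∀ x ∈ D, diracOp A ε f x = (lam : ℂ) • f x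

/-- `Re x → +∞` in `D`. -/
def rightEnd (D : Set ℂ) : Filter ℂ := comap Complex.re atTop ⊓ 𝓟 D

/-- `Re x → -∞` in `D`. -/
def leftEnd (D : Set ℂ) : Filter ℂ := comap Complex.re atBot ⊓ 𝓟 D

/-- The Jost solution `f₊` at the end `l`: a solution on `D` with
`f₊(x) = e^{i lam x/ε} ((0, 1)ᵀ + o(1))` along `l`. -/
def IsJostPlus (A : ℂ → ℂ) (D : Set ℂ) (l : Filter ℂ) (ε lam : ℝ)
    (f : ℂ → Fin 2 → ℂ) : Prop :=
  IsDiracSolution A D ε lam f ∧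
    Tendsto (fun x : ℂ => Complex.exp (-(Complex.I * lam * x / ε)) • f x) l (𝓝 ![0, 1])

/-- The Jost solution `f₋` at the end `l`: a solution on `D` with
`f₋(x) = e^{-i lam x/ε} ((1, 0)ᵀ + o(1))` along `l`. -/
def IsJostMinus (A : ℂ → ℂ) (D : Set ℂ) (l : Filter ℂ) (ε lam : ℝ)
    (f : ℂ → Fin 2 → ℂ) : Prop :=
  IsDiracSolution A D ε lam f ∧
    Tendsto (fun x : ℂ => Complex.exp (Complex.I * lam * x / ε) • f x) l (𝓝 ![1, 0])

/-- `T` is the constant matrix of the change of basis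
`(fˡ₊, fˡ₋) = (fʳ₊, fʳ₋) T` between the left and right Jost solutions. -/
def IsTransitionMatrix (A : ℂ → ℂ) (D : Set ℂ) (ε lam : ℝ)
    (T : Matrix (Fin 2) (Fin 2) ℂ) : Prop :=
  ∃ frp frm flp flm : ℂ → Fin 2 → ℂ,
    IsJostPlus A D (rightEnd D) ε lam frp ∧ IsJostMinus A D (rightEnd D) ε lam frm ∧
    IsJostPlus A D (leftEnd D) ε lam flp ∧ IsJostMinus A D (leftEnd D) ε lam flm ∧
    ∀ x ∈ D, flp x = T 0 0 • frp x + T 1 0 • frm x ∧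
      flm x = T 0 1 • frp x + T 1 1 • frm x

/-- The transition matrix `T(lam, ε)`; meaningful when exactly one matrix satisfies
`IsTransitionMatrix`. -/
def transitionMatrix (A : ℂ → ℂ) (D : Set ℂ) (ε lam : ℝ) : Matrix (Fin 2) (Fin 2) ℂ :=
  Classical.epsilon (IsTransitionMatrix A D ε lam)

/-- The coefficient `a(lam, ε)`. -/
def coeffA (A : ℂ → ℂ) (D : Set ℂ) (ε lam : ℝ) : ℂ := transitionMatrix A D ε lam 0 0

/-- The coefficient `b(lam, ε)`. -/
def coeffB (A : ℂ → ℂ) (D : Set ℂ) (ε lam : ℝ) : ℂ := transitionMatrix A D ε lam 1 0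

/-- The reflection coefficient `R(lam, ε) = b(lam, ε) / a(lam, ε)`. -/
def reflectionCoeff (A : ℂ → ℂ) (D : Set ℂ) (ε lam : ℝ) : ℂ :=
  coeffB A D ε lam / coeffA A D ε lam

end

/-! With `k = lam / ε` and `B = A / ε` the equation reads `f' = -ikf + Bg`, `g' = ikg - Bf`. The
rotated components `e^{ikx} f` and `e^{-ikx} g` solve an off-diagonal system whose coefficients are
integrable at both ends of the real axis, so they have limits there, and these limits determine the
solution. The Jost conditions, although imposed on whole sectors, amount to the limits `(0, 1)` and
`(1, 0)` on the real axis (`RightDecay.jostPlus_iff`): with weights `e^{±k Im x}` the estimates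
along horizontal lines are uniform in the height. Hence `T` is the linear map from left limits to
right limits, and the solution with left limits `(0, 1)` has right limits `(b, a)`
(`isTransitionMatrix_iff`).

For the smallness of `b`, put `p = A / lam`, `q = √(1 + p²)`, `α = p / (1 + q)`. The combinations `f
+ iαg` and `iαf + g` diagonalise the system with rates `∓ikq`, up to terms in `α'` that carry no
factor `k` (`PhaseBounds.hasDerivAt_diagonal`). The real axis is then shifted to the curve `t +
is/q(t)`, along which `Im (q dx)` is only `O(s²)` times an integrable weight; so the energy of the
diagonal components grows at most by the factor `exp (O(|k| s²) + O(1))` (`PhaseBounds.energy_le`).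
The curve approaches height `s` at both ends, where `|g|` tends to `e^{-ks}` on the left and `|f|`
to `e^{ks} |b|` on the right. Therefore `|b| ≤ exp (-2ks + O(|k| s²) + O(1))`
(`PhaseBounds.norm_scatter_le`). Taking `ks > 0` and `|s|` small but fixed gives `|b| ≤ exp (M -
σ/ε)`. Since `A` is real on the real axis, `|a|² + |b|² = 1`, so `a` stays away from `0` and `b/a`
inherits the bound. -/

/-! ### Linear holomorphic differential equations on star-shaped domains. -/

/-- A holomorphic function on an open set that is star-shaped about the origin has a primitive,
given by integration along rays. -/
theorem hasDerivAt_integral_ray {E : Type*} [NormedAddCommGroup E] [NormedSpace ℂ E]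
    [CompleteSpace E] {U : Set ℂ} (hU : IsOpen U) (hs : StarConvex ℝ 0 U) {g : ℂ → E}
    (hg : DifferentiableOn ℂ g U) {x : ℂ} (hx : x ∈ U) :
    HasDerivAt (fun y : ℂ => ∫ t in (0 : ℝ)..1, y • g ((t : ℂ) * y)) (g x) x := by
  have hmem : ∀ y ∈ U, ∀ t ∈ Set.Icc (0 : ℝ) 1, (t : ℂ) * y ∈ U := by
    intro y hy t ht
    have := hs.smul_mem hy ht.1 ht.2
    simpa [Complex.real_smul] using this
  obtain ⟨r, hr, hrU⟩ := Metric.nhds_basis_closedBall.mem_iff.1 (hU.mem_nhds hx)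
  have hg' : ContinuousOn (deriv g) U := (hg.deriv hU).continuousOn
  set F' : ℂ → ℝ → E := fun y t => g ((t : ℂ) * y) + ((t : ℂ) * y) • deriv g ((t : ℂ) * y) with hF'
  have hmaps : Set.MapsTo (fun z : ℝ × ℂ => (z.1 : ℂ) * z.2)
      (Set.Icc (0 : ℝ) 1 ×ˢ Metric.closedBall x r) U :=
    fun z hz => hmem _ (hrU hz.2) _ hz.1
  have hcm : ContinuousOn (fun z : ℝ × ℂ => (z.1 : ℂ) * z.2)
      (Set.Icc (0 : ℝ) 1 ×ˢ Metric.closedBall x r) := by fun_prop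
  have hcont : ContinuousOn (fun z : ℝ × ℂ => F' z.2 z.1)
      (Set.Icc (0 : ℝ) 1 ×ˢ Metric.closedBall x r) :=
    (hg.continuousOn.comp hcm hmaps).add (hcm.smul (hg'.comp hcm hmaps))
  obtain ⟨C, hC⟩ := (isCompact_Icc.prod (isCompact_closedBall x r)).exists_bound_of_continuousOn hcont
  have hgt : ∀ y ∈ Metric.closedBall x r,
      ContinuousOn (fun t : ℝ => g ((t : ℂ) * y)) (Set.Icc 0 1) := fun y hy =>
    hg.continuousOn.comp (by fun_prop) (fun t ht => hmem y (hrU hy) t ht)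
  have hFt : ∀ y ∈ Metric.closedBall x r, ContinuousOn (F' y) (Set.Icc 0 1) := fun y hy =>
    hcont.comp (f := fun t : ℝ => (t, y)) (by fun_prop) (fun t ht => ⟨ht, hy⟩)
  have hxr : x ∈ Metric.closedBall x r := Metric.mem_closedBall_self hr.le
  have hι : Set.uIoc (0 : ℝ) 1 ⊆ Set.Icc 0 1 := by
    rw [Set.uIoc_of_le zero_le_one]; exact Set.Ioc_subset_Icc_self
  have key := intervalIntegral.hasDerivAt_integral_of_dominated_loc_of_deriv_le
    (μ := MeasureTheory.volume) (a := 0) (b := 1) (F := fun (y : ℂ) (t : ℝ) => y • g ((t : ℂ) * y))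
    (F' := F') (x₀ := x) (s := Metric.ball x r) (bound := fun _ => C) (Metric.ball_mem_nhds x hr)
    ?_ ?_ ?_ ?_ ?_ ?_
  · have h2 : ∫ t in (0 : ℝ)..1, F' x t = g x := by
      have := intervalIntegral.integral_eq_sub_of_hasDerivAt (a := 0) (b := 1)
        (f := fun t : ℝ => (t : ℂ) • g ((t : ℂ) * x)) (f' := F' x) ?_ ?_
      · simpa using this
      · intro t ht
        rw [Set.uIcc_of_le zero_le_one] at ht
        have h1 : HasDerivAt g (deriv g ((t : ℂ) * x)) ((t : ℂ) * x) :=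
          (hg.differentiableAt (hU.mem_nhds (hmem x hx t ht))).hasDerivAt
        have h3 : HasDerivAt (fun z : ℂ => z • g (z * x))
            (F' x t) (t : ℂ) := by
          have h4 := h1.scomp (t : ℂ) ((hasDerivAt_id (t : ℂ)).mul_const x)
          have h5 := (hasDerivAt_id (t : ℂ)).smul h4
          convert! h5 using 1
          simp [hF', smul_smul, add_comm]
        have h6 := h3.scomp t Complex.ofRealCLM.hasDerivAt
        simpa [Function.comp_def] using h6
      · refine ContinuousOn.intervalIntegrable ?_
        rw [Set.uIcc_of_le zero_le_one]; exact hFt x hxr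
    rw [← h2]; exact key.2
  · filter_upwards [Metric.ball_mem_nhds x hr] with y hy
    exact (((hgt y (Metric.ball_subset_closedBall hy)).const_smul y).mono hι).aestronglyMeasurable
      measurableSet_uIoc
  · refine ContinuousOn.intervalIntegrable ?_
    rw [Set.uIcc_of_le zero_le_one]
    exact (hgt x hxr).const_smul x
  · exact ((hFt x hxr).mono hι).aestronglyMeasurable measurableSet_uIoc
  · exact Eventually.of_forall fun t ht y hy =>
      hC (t, y) ⟨hι ht, Metric.ball_subset_closedBall hy⟩
  · exact intervalIntegrable_const
  · refine Eventually.of_forall fun t ht y hy => ?_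
    have h1 : HasDerivAt g (deriv g ((t : ℂ) * y)) ((t : ℂ) * y) :=
      (hg.differentiableAt (hU.mem_nhds
        (hmem y (hrU (Metric.ball_subset_closedBall hy)) t (hι ht)))).hasDerivAt
    have h4 := h1.scomp y ((hasDerivAt_id y).const_mul (t : ℂ))
    have h5 := (hasDerivAt_id y).smul h4
    convert! h5 using 1
    simp only [hF', id, one_smul, mul_one, smul_smul, Function.comp]
    rw [add_comm, mul_comm y]

/-- The terms of the Picard series of the linear equation `f' = M f`, `f 0 = v`. -/
noncomputable def picardTerm {E : Type*} [NormedAddCommGroup E] [NormedSpace ℂ E]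
    (M : ℂ → E →L[ℂ] E) (v : E) : ℕ → ℂ → E
  | 0 => fun _ => v
  | n + 1 => fun x => ∫ t in (0 : ℝ)..1, x • M ((t : ℂ) * x) (picardTerm M v n ((t : ℂ) * x))

section Picard

variable {E : Type*} [NormedAddCommGroup E] [NormedSpace ℂ E] {U : Set ℂ}
  {M : ℂ → E →L[ℂ] E}

theorem differentiableOn_picardTerm [CompleteSpace E] (hU : IsOpen U)
    (hs : StarConvex ℝ 0 U)
    (hM : DifferentiableOn ℂ M U) (v : E) (n : ℕ) : DifferentiableOn ℂ (picardTerm M v n) U := by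
  induction n with
  | zero => exact differentiableOn_const v
  | succ n ih =>
    exact fun x hx => (hasDerivAt_integral_ray hU hs
      (hM.clm_apply ih) hx).differentiableAt.differentiableWithinAt

theorem hasDerivAt_picardTerm_succ [CompleteSpace E] (hU : IsOpen U)
    (hs : StarConvex ℝ 0 U)
    (hM : DifferentiableOn ℂ M U) (v : E) (n : ℕ) {x : ℂ} (hx : x ∈ U) :
    HasDerivAt (picardTerm M v (n + 1)) (M x (picardTerm M v n x)) x :=
  hasDerivAt_integral_ray hU hs (hM.clm_apply (differentiableOn_picardTerm hU hs hM v n)) hx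

theorem picardTerm_succ_zero (v : E) (n : ℕ) : picardTerm M v (n + 1) 0 = 0 := by
  simp [picardTerm]

/-- The `n`-th term at `t x` carries a factor `t ^ n`, and each integration over `[0, 1]`
contributes `1 / (n + 1)`; this builds the factorial. Only the values of `M` on the segment from `0`
to `x` enter. -/
theorem norm_picardTerm_le (v : E) {K : ℝ} (hK : 0 ≤ K) (n : ℕ) :
    ∀ x : ℂ, (∀ t ∈ Set.Icc (0 : ℝ) 1, ‖M ((t : ℂ) * x)‖ ≤ K) →
      ‖picardTerm M v n x‖ ≤ ‖v‖ * (K * ‖x‖) ^ n / n.factorial := by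
  induction n with
  | zero => intro x _; simp [picardTerm]
  | succ n ih =>
    intro x hx
    have hb : ∀ t ∈ Set.Icc (0 : ℝ) 1,
        ‖x • M ((t : ℂ) * x) (picardTerm M v n ((t : ℂ) * x))‖ ≤
          (‖v‖ * (K * ‖x‖) ^ (n + 1) / n.factorial) * t ^ n := by
      intro t ht
      have h1 := ih ((t : ℂ) * x) (fun s hs => by
        have := hx (s * t) ⟨mul_nonneg hs.1 ht.1, mul_le_one₀ hs.2 ht.1 ht.2⟩
        rwa [Complex.ofReal_mul, mul_assoc] at this)
      rw [norm_smul]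
      have h2 := (M ((t : ℂ) * x)).le_opNorm (picardTerm M v n ((t : ℂ) * x))
      have h3 : ‖(t : ℂ) * x‖ = t * ‖x‖ := by simp [abs_of_nonneg ht.1]
      rw [h3] at h1
      calc ‖x‖ * ‖M ((t : ℂ) * x) (picardTerm M v n ((t : ℂ) * x))‖
          ≤ ‖x‖ * (K * (‖v‖ * (K * (t * ‖x‖)) ^ n / n.factorial)) := by
            gcongr
            exact h2.trans (mul_le_mul (hx t ht) h1 (norm_nonneg _) hK)
        _ = _ := by rw [show K * (t * ‖x‖) = K * ‖x‖ * t by ring, mul_pow]; ring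
    have := intervalIntegral.norm_integral_le_of_norm_le (μ := MeasureTheory.volume)
      (a := (0 : ℝ)) (b := 1)
      (f := fun t : ℝ => x • M ((t : ℂ) * x) (picardTerm M v n ((t : ℂ) * x)))
      (g := fun t => (‖v‖ * (K * ‖x‖) ^ (n + 1) / n.factorial) * t ^ n) zero_le_one
      (Eventually.of_forall fun t ht => hb t ⟨ht.1.le, ht.2⟩)
      (Continuous.intervalIntegrable (by fun_prop) _ _)
    refine this.trans_eq ?_
    rw [intervalIntegral.integral_const_mul, integral_pow, Nat.factorial_succ]
    have : (n.factorial : ℝ) ≠ 0 := by positivity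
    push_cast
    field_simp
    simp

/-- A linear holomorphic differential equation on an open set star-shaped about the origin has a
solution with any prescribed value at the origin. -/
theorem exists_hasDerivAt_linear [CompleteSpace E] (hU : IsOpen U) (hs : StarConvex ℝ 0 U)
    (hM : DifferentiableOn ℂ M U) (v : E) :
    ∃ f : ℂ → E, f 0 = v ∧ ∀ x ∈ U, HasDerivAt f (M x (f x)) x := by
  refine ⟨fun x => ∑' n, picardTerm M v n x, ?_, fun x hx => ?_⟩
  · refine (tsum_eq_single 0 ?_).trans ?_
    · rintro (_ | n) hn
      · exact absurd rfl hn
      · exact picardTerm_succ_zero v n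
    · rfl
  obtain ⟨r, hr, hrU⟩ := Metric.nhds_basis_closedBall.mem_iff.1 (hU.mem_nhds hx)
  have hcm : ContinuousOn (fun z : ℝ × ℂ => (z.1 : ℂ) * z.2)
      (Set.Icc (0 : ℝ) 1 ×ˢ Metric.closedBall x r) := by fun_prop
  obtain ⟨C, hC⟩ := (isCompact_Icc.prod (isCompact_closedBall x r)).exists_bound_of_continuousOn
    (hM.continuousOn.comp hcm (fun z hz => by
      have := hs.smul_mem (hrU hz.2) hz.1.1 hz.1.2
      simpa [Complex.real_smul] using this))
  set K := max C 0
  have hK : 0 ≤ K := le_max_right _ _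
  set N := ‖x‖ + r
  have hN : 0 ≤ N := by positivity
  have hbd : ∀ n, ∀ y ∈ Metric.closedBall x r,
      ‖picardTerm M v n y‖ ≤ ‖v‖ * (K * N) ^ n / n.factorial := by
    intro n y hy
    have hy' : ‖y‖ ≤ N := by
      have := norm_le_norm_add_norm_sub' y x
      rw [mem_closedBall_iff_norm] at hy
      linarith
    refine (norm_picardTerm_le v hK n y fun t ht => (hC (t, y) ⟨ht, hy⟩).trans
      (le_max_left _ _)).trans ?_
    gcongr
  have hMK : ∀ y ∈ Metric.closedBall x r, ‖M y‖ ≤ K := fun y hy => by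
    have := hC (1, y) ⟨⟨zero_le_one, le_rfl⟩, hy⟩
    simp only [Function.comp, Complex.ofReal_one, one_mul] at this
    exact this.trans (le_max_left _ _)
  have hsum : Summable fun n : ℕ => ‖v‖ * (K * N) ^ n / n.factorial := by
    simp_rw [mul_div_assoc]
    exact (Real.summable_pow_div_factorial (K * N)).mul_left _
  -- The term of index `0` is constant and has derivative `0`; the derivative of term `n + 1` is `M`
  -- applied to term `n`. This shift turns the differentiated series into `M` applied to the sum.
  let u : ℕ → ℝ := fun n => n.casesOn 0 fun n => K * (‖v‖ * (K * N) ^ n / n.factorial)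
  let g' : ℕ → ℂ → E := fun n y => n.casesOn 0 fun n => M y (picardTerm M v n y)
  have hu : Summable u := (summable_nat_add_iff 1).1 (hsum.mul_left K)
  have hxr : x ∈ Metric.ball x r := Metric.mem_ball_self hr
  have hs1 : Summable fun n => picardTerm M v n x :=
    .of_norm_bounded hsum fun n => hbd n x (Metric.ball_subset_closedBall hxr)
  have key := hasDerivAt_tsum_of_isPreconnected (𝕜 := ℂ) (g := picardTerm M v) (g' := g') hu
    Metric.isOpen_ball (convex_ball x r).isPreconnected ?_ ?_ hxr hs1 hxr
  · convert key using 1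
    have : Summable fun n => g' n x := .of_norm_bounded hu fun n => by
      rcases n with _ | n
      · simp [g', u]
      · have h1 := hbd n x (Metric.ball_subset_closedBall hxr)
        exact ((M x).le_opNorm _).trans
          (mul_le_mul (hMK x (Metric.ball_subset_closedBall hxr)) h1 (norm_nonneg _) hK)
    rw [this.tsum_eq_zero_add, (M x).map_tsum hs1]
    simp [g']
  · rintro (_ | n) y hy
    · exact hasDerivAt_const y v
    · exact hasDerivAt_picardTerm_succ hU hs hM v n (hrU (Metric.ball_subset_closedBall hy))
  · rintro (_ | n) y hy
    · simp [g', u]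
    · have h1 := hbd n y (Metric.ball_subset_closedBall hy)
      exact ((M y).le_opNorm _).trans
        (mul_le_mul (hMK y (Metric.ball_subset_closedBall hy)) h1 (norm_nonneg _) hK)

end Picard

/-! ### The Dirac equation as a system for two scalar functions, and Wronskians. -/

/-- `(f, g)` solves `f' = -i k f + B g`, `g' = i k g - B f` on `U`. -/
def IsDiracPair (B : ℂ → ℂ) (k : ℝ) (U : Set ℂ) (f g : ℂ → ℂ) : Prop :=
  ∀ x ∈ U, HasDerivAt f (-(Complex.I * k) * f x + B x * g x) x ∧
    HasDerivAt g (Complex.I * k * g x - B x * f x) x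

theorem exists_isDiracPair {B : ℂ → ℂ} {U : Set ℂ} (k : ℝ) (hU : IsOpen U)
    (hs : StarConvex ℝ 0 U) (hB : DifferentiableOn ℂ B U) (c d : ℂ) :
    ∃ f g : ℂ → ℂ, f 0 = c ∧ g 0 = d ∧ IsDiracPair B k U f g := by
  let p : ℂ × ℂ →L[ℂ] ℂ := ContinuousLinearMap.fst ℂ ℂ ℂ
  let q : ℂ × ℂ →L[ℂ] ℂ := ContinuousLinearMap.snd ℂ ℂ ℂ
  let M : ℂ → ℂ × ℂ →L[ℂ] ℂ × ℂ := fun x =>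
    ((-(Complex.I * k)) • p).prod ((Complex.I * k) • q) + B x • q.prod (-p)
  have hM : DifferentiableOn ℂ M U := (hB.smul_const _).const_add _
  obtain ⟨F, h0, hF⟩ := exists_hasDerivAt_linear hU hs hM (c, d)
  refine ⟨fun x => (F x).1, fun x => (F x).2, by simp [h0], by simp [h0], fun x hx => ⟨?_, ?_⟩⟩
  · have := p.hasFDerivAt.comp_hasDerivAt x (hF x hx)
    convert! this using 1
  · have := q.hasFDerivAt.comp_hasDerivAt x (hF x hx)
    convert! this using 1
    simp [M, p, q, sub_eq_add_neg]

/-- The Wronskian of two pairs of functions. -/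
def pairWronskian (f g f' g' : ℂ → ℂ) (x : ℂ) : ℂ := f x * g' x - g x * f' x

section Pair

variable {B : ℂ → ℂ} {k : ℝ} {U : Set ℂ} {f g f₁ g₁ f₂ g₂ : ℂ → ℂ}

theorem IsDiracPair.linear_combination (h₁ : IsDiracPair B k U f₁ g₁)
    (h₂ : IsDiracPair B k U f₂ g₂) (a b : ℂ) :
    IsDiracPair B k U (fun x => a * f₁ x + b * f₂ x) (fun x => a * g₁ x + b * g₂ x) := by
  intro x hx
  refine ⟨?_, ?_⟩
  · exact (((h₁ x hx).1.const_mul a).add ((h₂ x hx).1.const_mul b)).congr_deriv (by ring)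
  · exact (((h₁ x hx).2.const_mul a).add ((h₂ x hx).2.const_mul b)).congr_deriv (by ring)

/-- The reflection exchanges the two ends at the price of new parameters, so the asymptotic analysis
is needed at `+∞` only. -/
theorem IsDiracPair.comp_neg (h : IsDiracPair B k U f g) (hU : ∀ x ∈ U, -x ∈ U) :
    IsDiracPair (fun x => -B (-x)) (-k) U (fun x => f (-x)) (fun x => g (-x)) := by
  intro x hx
  refine ⟨?_, ?_⟩
  · exact ((h (-x) (hU x hx)).1.scomp x (hasDerivAt_neg x)).congr_deriv (by simp; ring)
  · exact ((h (-x) (hU x hx)).2.scomp x (hasDerivAt_neg x)).congr_deriv (by simp; ring)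

/-- The coefficient matrix of the system has trace zero, so the Wronskian has zero derivative. -/
theorem IsDiracPair.wronskian_eq (h₁ : IsDiracPair B k U f₁ g₁) (h₂ : IsDiracPair B k U f₂ g₂)
    (hU : IsOpen U) (hc : IsPreconnected U) {x y : ℂ} (hx : x ∈ U) (hy : y ∈ U) :
    pairWronskian f₁ g₁ f₂ g₂ x = pairWronskian f₁ g₁ f₂ g₂ y := by
  have hd : ∀ z ∈ U, HasDerivAt (pairWronskian f₁ g₁ f₂ g₂) 0 z := fun z hz =>
    (((h₁ z hz).1.mul (h₂ z hz).2).sub ((h₁ z hz).2.mul (h₂ z hz).1)).congr_deriv (by ring)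
  exact hU.is_const_of_deriv_eq_zero hc
    (fun z hz => (hd z hz).differentiableAt.differentiableWithinAt)
    (fun z hz => (hd z hz).deriv) hx hy

/-- Expansion of a solution in a basis, with coefficients given by Wronskians at a point. -/
theorem IsDiracPair.expansion (h : IsDiracPair B k U f g) (h₁ : IsDiracPair B k U f₁ g₁)
    (h₂ : IsDiracPair B k U f₂ g₂) (hU : IsOpen U) (hc : IsPreconnected U) {y : ℂ} (hy : y ∈ U)
    (hw : pairWronskian f₁ g₁ f₂ g₂ y ≠ 0) {x : ℂ} (hx : x ∈ U) :
    f x = pairWronskian f g f₂ g₂ y / pairWronskian f₁ g₁ f₂ g₂ y * f₁ x +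
        pairWronskian f₁ g₁ f g y / pairWronskian f₁ g₁ f₂ g₂ y * f₂ x ∧
      g x = pairWronskian f g f₂ g₂ y / pairWronskian f₁ g₁ f₂ g₂ y * g₁ x +
        pairWronskian f₁ g₁ f g y / pairWronskian f₁ g₁ f₂ g₂ y * g₂ x := by
  rw [← h₁.wronskian_eq h₂ hU hc hx hy] at hw ⊢
  rw [← h.wronskian_eq h₂ hU hc hx hy, ← h₁.wronskian_eq h hU hc hx hy]
  constructor
  · field_simp
    simp only [pairWronskian]
    ring
  · field_simp
    simp only [pairWronskian]
    ring

end Pair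

theorem isDiracSolution_iff {A : ℂ → ℂ} {U : Set ℂ} {ε : ℝ} (lam : ℝ) (hU : IsOpen U)
    (hε : ε ≠ 0) (F : ℂ → Fin 2 → ℂ) :
    IsDiracSolution A U ε lam F ↔
      IsDiracPair (fun x => A x / ε) (lam / ε) U (fun x => F x 0) (fun x => F x 1) := by
  have hε' : (ε : ℂ) ≠ 0 := by exact_mod_cast hε
  have hI := Complex.I_sq
  have hI0 := Complex.I_ne_zero
  constructor
  · rintro ⟨hd, he⟩ x hx
    have hF := hd.differentiableAt (hU.mem_nhds hx)
    rw [differentiableAt_pi] at hF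
    have h0 := congrFun (he x hx) 0
    have h1 := congrFun (he x hx) 1
    simp only [diracOp, Matrix.cons_val_zero, Matrix.cons_val_one, Pi.smul_apply, smul_eq_mul,
      Complex.div_I] at h0 h1
    refine ⟨(hF 0).hasDerivAt.congr_deriv ?_, (hF 1).hasDerivAt.congr_deriv ?_⟩
    · push_cast
      field_simp
      linear_combination (-Complex.I) * h0 +
        (ε * deriv (fun y => F y 0) x - A x * F x 1) * hI
    · push_cast
      field_simp
      linear_combination (Complex.I) * h1 +
        (A x * F x 0 + ε * deriv (fun y => F y 1) x) * hI
  · intro h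
    refine ⟨fun x hx => ?_, fun x hx => ?_⟩
    · refine DifferentiableAt.differentiableWithinAt (differentiableAt_pi.2 fun i => ?_)
      fin_cases i
      · exact (h x hx).1.differentiableAt
      · exact (h x hx).2.differentiableAt
    · ext i
      fin_cases i
      · simp only [diracOp, (h x hx).1.deriv, Complex.div_I]
        simp
        field_simp
        linear_combination (-(lam : ℂ) * F x 0) * hI
      · simp only [diracOp, (h x hx).2.deriv, Complex.div_I]
        simp
        field_simp
        linear_combination (-(lam : ℂ) * F x 1) * hI

/-! ### Energy estimates and limits at infinity for off-diagonal systems on the line. -/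

/-- Gronwall's inequality with a variable rate, given through an antiderivative. -/
theorem le_mul_exp_sub_of_hasDerivAt_le {E P e p : ℝ → ℝ} {a b : ℝ} (hab : a ≤ b)
    (hE : ∀ t ∈ Set.Icc a b, HasDerivAt E (e t) t) (hP : ∀ t ∈ Set.Icc a b, HasDerivAt P (p t) t)
    (h : ∀ t ∈ Set.Icc a b, e t ≤ p t * E t) : E b ≤ E a * Real.exp (P b - P a) := by
  have hd : ∀ t ∈ Set.Icc a b, HasDerivAt (fun t => E t * Real.exp (-P t))
      (e t * Real.exp (-P t) + E t * (Real.exp (-P t) * -p t)) t := fun t ht =>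
    (hE t ht).mul (hP t ht).neg.exp
  have hanti : AntitoneOn (fun t => E t * Real.exp (-P t)) (Set.Icc a b) := by
    refine antitoneOn_of_deriv_nonpos (convex_Icc a b)
      (fun t ht => (hd t ht).continuousAt.continuousWithinAt)
      (fun t ht => (hd t (interior_subset ht)).differentiableAt.differentiableWithinAt) ?_
    intro t ht
    have ht' := interior_subset ht
    rw [(hd t ht').deriv]
    have := mul_le_mul_of_nonneg_right (h t ht') (Real.exp_pos (-P t)).le
    linarith
  have := hanti (Set.left_mem_Icc.2 hab) (Set.right_mem_Icc.2 hab) hab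
  simp only at this
  rw [Real.exp_sub, ← mul_div_assoc, le_div_iff₀ (Real.exp_pos _)]
  rw [Real.exp_neg, Real.exp_neg, ← div_eq_mul_inv, ← div_eq_mul_inv,
    div_le_div_iff₀ (Real.exp_pos _) (Real.exp_pos _)] at this
  exact this

theorem hasDerivAt_norm_sq {u : ℝ → ℂ} {u' : ℂ} {t : ℝ} (h : HasDerivAt u u' t) :
    HasDerivAt (fun t => ‖u t‖ ^ 2) (2 * (starRingEnd ℂ (u t) * u').re) t := by
  have := h.norm_sq
  rwa [Complex.inner, mul_comm u'] at this

section Transport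

variable {u v c d : ℝ → ℂ} {P p : ℝ → ℝ} {a b : ℝ}

/-- Energy bound for an off-diagonal system `u' = c v`, `v' = d u`. -/
theorem offDiagonal_energy_le (hab : a ≤ b)
    (hu : ∀ t ∈ Set.Icc a b, HasDerivAt u (c t * v t) t)
    (hv : ∀ t ∈ Set.Icc a b, HasDerivAt v (d t * u t) t)
    (hP : ∀ t ∈ Set.Icc a b, HasDerivAt P (p t) t)
    (hc : ∀ t ∈ Set.Icc a b, ‖c t‖ ≤ p t) (hd : ∀ t ∈ Set.Icc a b, ‖d t‖ ≤ p t) :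
    ‖u b‖ ^ 2 + ‖v b‖ ^ 2 ≤ (‖u a‖ ^ 2 + ‖v a‖ ^ 2) * Real.exp (P b - P a) ^ 2 := by
  have := le_mul_exp_sub_of_hasDerivAt_le (E := fun t => ‖u t‖ ^ 2 + ‖v t‖ ^ 2)
    (P := fun t => 2 * P t) (p := fun t => 2 * p t) hab
    (fun t ht => (hasDerivAt_norm_sq (hu t ht)).add (hasDerivAt_norm_sq (hv t ht)))
    (fun t ht => (hP t ht).const_mul 2) ?_
  · refine this.trans_eq ?_
    rw [← Real.exp_nat_mul]
    congr 2
    push_cast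
    ring
  · intro t ht
    have h1 := Complex.re_le_norm (starRingEnd ℂ (u t) * (c t * v t))
    have h2 := Complex.re_le_norm (starRingEnd ℂ (v t) * (d t * u t))
    simp only [norm_mul, Complex.norm_conj] at h1 h2
    have h3 : ‖u t‖ * (‖c t‖ * ‖v t‖) ≤ p t * (‖u t‖ * ‖v t‖) := by
      have := mul_le_mul_of_nonneg_right (hc t ht) (by positivity : 0 ≤ ‖u t‖ * ‖v t‖)
      linarith
    have h4 : ‖v t‖ * (‖d t‖ * ‖u t‖) ≤ p t * (‖u t‖ * ‖v t‖) := by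
      have := mul_le_mul_of_nonneg_right (hd t ht) (by positivity : 0 ≤ ‖u t‖ * ‖v t‖)
      linarith
    have h5 : p t * (2 * ‖u t‖ * ‖v t‖) ≤ p t * (‖u t‖ ^ 2 + ‖v t‖ ^ 2) :=
      mul_le_mul_of_nonneg_left (two_mul_le_add_sq _ _) ((norm_nonneg _).trans (hc t ht))
    linarith

/-- The energy bound controls `v` on the whole interval, and integrating `u' = c v` gives the extra
factor `P b - P a`. It is this factor, small far out, that produces limits. -/
theorem offDiagonal_norm_sub_le (hab : a ≤ b)
    (hu : ∀ t ∈ Set.Icc a b, HasDerivAt u (c t * v t) t)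
    (hv : ∀ t ∈ Set.Icc a b, HasDerivAt v (d t * u t) t)
    (hP : ∀ t ∈ Set.Icc a b, HasDerivAt P (p t) t)
    (hc : ∀ t ∈ Set.Icc a b, ‖c t‖ ≤ p t) (hd : ∀ t ∈ Set.Icc a b, ‖d t‖ ≤ p t) :
    ‖u b - u a‖ ≤ √(‖u a‖ ^ 2 + ‖v a‖ ^ 2) * Real.exp (P b - P a) * (P b - P a) := by
  set K := √(‖u a‖ ^ 2 + ‖v a‖ ^ 2) * Real.exp (P b - P a) with hK
  have hp : ∀ t ∈ Set.Icc a b, 0 ≤ p t := fun t ht => (norm_nonneg _).trans (hc t ht)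
  have hmono : MonotoneOn P (Set.Icc a b) :=
    monotoneOn_of_deriv_nonneg (convex_Icc a b)
      (fun t ht => (hP t ht).continuousAt.continuousWithinAt)
      (fun t ht => (hP t (interior_subset ht)).differentiableAt.differentiableWithinAt)
      (fun t ht => (hP t (interior_subset ht)).deriv ▸ hp t (interior_subset ht))
  have hvK : ∀ t ∈ Set.Icc a b, ‖v t‖ ≤ K := by
    intro t ht
    have hsub : Set.Icc a t ⊆ Set.Icc a b := Set.Icc_subset_Icc_right ht.2
    have := offDiagonal_energy_le ht.1 (fun s hs => hu s (hsub hs)) (fun s hs => hv s (hsub hs))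
      (fun s hs => hP s (hsub hs)) (fun s hs => hc s (hsub hs)) (fun s hs => hd s (hsub hs))
    have h2 : P t ≤ P b := hmono ht (Set.right_mem_Icc.2 hab) ht.2
    refine abs_le_of_sq_le_sq' (a := ‖v t‖) (b := K) ?_ (by positivity) |>.2
    rw [hK, mul_pow, Real.sq_sqrt (by positivity)]
    have h3 : Real.exp (P t - P a) ^ 2 ≤ Real.exp (P b - P a) ^ 2 := by gcongr
    have h4 := mul_le_mul_of_nonneg_left h3 (by positivity : 0 ≤ ‖u a‖ ^ 2 + ‖v a‖ ^ 2)
    nlinarith [sq_nonneg ‖u t‖]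
  have := image_norm_le_of_norm_deriv_right_le_deriv_boundary' (a := a) (b := b)
    (f := fun t => u t - u a) (f' := fun t => c t * v t) (B := fun t => K * (P t - P a))
    (B' := fun t => K * p t)
    (fun t ht => ((hu t ht).sub_const _).continuousAt.continuousWithinAt)
    (fun t ht => ((hu t (Set.Ico_subset_Icc_self ht)).sub_const _).hasDerivWithinAt)
    (by simp)
    (fun t ht => (((hP t ht).sub_const _).const_mul K).continuousAt.continuousWithinAt)
    (fun t ht => (((hP t (Set.Ico_subset_Icc_self ht)).sub_const _).const_mul K).hasDerivWithinAt)
    ?_ (Set.right_mem_Icc.2 hab)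
  · exact this
  · intro t ht
    have ht' := Set.Ico_subset_Icc_self ht
    rw [norm_mul, mul_comm]
    exact mul_le_mul (hvK t ht') (hc t ht') (norm_nonneg _) (by positivity)

/-- The previous bound with the reference point at the right end of the interval. -/
theorem offDiagonal_norm_sub_le_right (hab : a ≤ b)
    (hu : ∀ t ∈ Set.Icc a b, HasDerivAt u (c t * v t) t)
    (hv : ∀ t ∈ Set.Icc a b, HasDerivAt v (d t * u t) t)
    (hP : ∀ t ∈ Set.Icc a b, HasDerivAt P (p t) t)
    (hc : ∀ t ∈ Set.Icc a b, ‖c t‖ ≤ p t) (hd : ∀ t ∈ Set.Icc a b, ‖d t‖ ≤ p t) :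
    ‖u b - u a‖ ≤ √(‖u b‖ ^ 2 + ‖v b‖ ^ 2) * Real.exp (P b - P a) * (P b - P a) := by
  have hmem : ∀ t ∈ Set.Icc (-b) (-a), -t ∈ Set.Icc a b := fun t ht =>
    ⟨by linarith [ht.2], by linarith [ht.1]⟩
  have := offDiagonal_norm_sub_le (u := fun t => u (-t)) (v := fun t => v (-t))
    (c := fun t => -c (-t)) (d := fun t => -d (-t)) (P := fun t => -P (-t)) (p := fun t => p (-t))
    (neg_le_neg hab)
    (fun t ht => ((hu (-t) (hmem t ht)).scomp t (hasDerivAt_neg t)).congr_deriv (by simp))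
    (fun t ht => ((hv (-t) (hmem t ht)).scomp t (hasDerivAt_neg t)).congr_deriv (by simp))
    (fun t ht => ((hP (-t) (hmem t ht)).scomp t (hasDerivAt_neg t)).neg.congr_deriv (by simp))
    (fun t ht => by simpa using hc (-t) (hmem t ht))
    (fun t ht => by simpa using hd (-t) (hmem t ht))
  simp only [neg_neg] at this
  rw [norm_sub_rev]
  refine this.trans_eq ?_
  rw [show -P a - -P b = P b - P a by ring]

end Transport

section OffDiagonalLimit

variable {u v c d : ℝ → ℂ} {P p : ℝ → ℝ} {R : ℝ}

/-- With this normalisation `-P t` is the integral of the rate over the tail `[t, ∞)`. -/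
theorem nonpos_of_monotone_tendsto_zero (hP : ∀ t ≥ R, HasDerivAt P (p t) t)
    (hp : ∀ t ≥ R, 0 ≤ p t) (hP0 : Tendsto P atTop (𝓝 0)) :
    MonotoneOn P (Set.Ici R) ∧ ∀ t ≥ R, P t ≤ 0 := by
  have hmono : MonotoneOn P (Set.Ici R) :=
    monotoneOn_of_deriv_nonneg (convex_Ici R)
      (fun t ht => (hP t ht).continuousAt.continuousWithinAt)
      (fun t ht => (hP t (interior_subset ht)).differentiableAt.differentiableWithinAt)
      (fun t ht => (hP t (interior_subset ht)).deriv ▸ hp t (interior_subset ht))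
  refine ⟨hmono, fun t ht => ge_of_tendsto hP0 ?_⟩
  filter_upwards [eventually_ge_atTop t] with s hs
  exact hmono ht (le_trans ht hs) hs

/-- An off-diagonal system with integrable coefficients has a limit at `+∞`. -/
theorem exists_tendsto_offDiagonal (hu : ∀ t ≥ R, HasDerivAt u (c t * v t) t)
    (hv : ∀ t ≥ R, HasDerivAt v (d t * u t) t) (hP : ∀ t ≥ R, HasDerivAt P (p t) t)
    (hc : ∀ t ≥ R, ‖c t‖ ≤ p t) (hd : ∀ t ≥ R, ‖d t‖ ≤ p t) (hP0 : Tendsto P atTop (𝓝 0)) :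
    ∃ L, Tendsto u atTop (𝓝 L) := by
  obtain ⟨-, hneg⟩ := nonpos_of_monotone_tendsto_zero hP
    (fun t ht => (norm_nonneg _).trans (hc t ht)) hP0
  -- Since `P` is nondecreasing and nonpositive, this one constant serves for all starting points `s
  -- ≥ R`; the tail `-P s` then gives the Cauchy criterion.
  set K := √((‖u R‖ ^ 2 + ‖v R‖ ^ 2) * Real.exp (-P R) ^ 2) * Real.exp (-P R)
  have hK : 0 ≤ K := by positivity
  have hkey : ∀ s t, R ≤ s → s ≤ t → ‖u t - u s‖ ≤ K * (-P s) := by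
    intro s t hs hst
    have hE := offDiagonal_energy_le hs (fun r hr => hu r hr.1) (fun r hr => hv r hr.1)
      (fun r hr => hP r hr.1) (fun r hr => hc r hr.1) (fun r hr => hd r hr.1)
    have hD := offDiagonal_norm_sub_le hst (fun r hr => hu r (hs.trans hr.1))
      (fun r hr => hv r (hs.trans hr.1)) (fun r hr => hP r (hs.trans hr.1))
      (fun r hr => hc r (hs.trans hr.1)) (fun r hr => hd r (hs.trans hr.1))
    obtain ⟨hm, -⟩ := nonpos_of_monotone_tendsto_zero hP
      (fun t ht => (norm_nonneg _).trans (hc t ht)) hP0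
    have h1 : P R ≤ P s := hm Set.self_mem_Ici hs hs
    have h2 : P s ≤ P t := hm hs (hs.trans hst) hst
    have h3 := hneg t (hs.trans hst)
    have h4 := hneg s hs
    refine hD.trans (mul_le_mul ?_ (by linarith) (by linarith) hK)
    refine mul_le_mul (Real.sqrt_le_sqrt (hE.trans ?_)) (Real.exp_le_exp.2 (by linarith))
      (Real.exp_pos _).le (Real.sqrt_nonneg _)
    gcongr
    linarith
  have hsmall : Tendsto (fun s => K * (-P s)) atTop (𝓝 0) := by
    simpa using (hP0.neg).const_mul K
  refine cauchySeq_tendsto_of_complete (Metric.cauchySeq_iff'.2 fun ε hε => ?_)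
  obtain ⟨N, hNR, hN⟩ := ((eventually_ge_atTop R).and (hsmall.eventually (gt_mem_nhds hε))).exists
  exact ⟨N, fun n hn => by rw [dist_eq_norm]; exact (hkey N n hNR hn).trans_lt hN⟩

/-- The estimate based at the right endpoint passes to the limit. The constant thus involves only
the limits, not the values at `R`, which is what makes it usable uniformly over all horizontal
lines. -/
theorem norm_sub_limit_offDiagonal_le (hu : ∀ t ≥ R, HasDerivAt u (c t * v t) t)
    (hv : ∀ t ≥ R, HasDerivAt v (d t * u t) t) (hP : ∀ t ≥ R, HasDerivAt P (p t) t)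
    (hc : ∀ t ≥ R, ‖c t‖ ≤ p t) (hd : ∀ t ≥ R, ‖d t‖ ≤ p t) (hP0 : Tendsto P atTop (𝓝 0))
    {a b : ℂ} (ha : Tendsto u atTop (𝓝 a)) (hb : Tendsto v atTop (𝓝 b)) :
    ‖u R - a‖ ≤ √(‖a‖ ^ 2 + ‖b‖ ^ 2) * Real.exp (-P R) * (-P R) := by
  rw [norm_sub_rev]
  have h1 : Tendsto (fun t => ‖u t - u R‖) atTop (𝓝 ‖a - u R‖) := (ha.sub_const _).norm
  have h2 : Tendsto (fun t => √(‖u t‖ ^ 2 + ‖v t‖ ^ 2) * Real.exp (P t - P R) * (P t - P R)) atTop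
      (𝓝 (√(‖a‖ ^ 2 + ‖b‖ ^ 2) * Real.exp (0 - P R) * (0 - P R))) :=
    ((((ha.norm.pow 2).add (hb.norm.pow 2)).sqrt).mul
      ((hP0.sub_const _).rexp)).mul (hP0.sub_const _)
  simp only [zero_sub] at h2
  refine le_of_tendsto_of_tendsto h1 h2 ?_
  filter_upwards [eventually_ge_atTop R] with t ht
  exact offDiagonal_norm_sub_le_right ht (fun r hr => hu r hr.1) (fun r hr => hv r hr.1)
      (fun r hr => hP r hr.1) (fun r hr => hc r hr.1) (fun r hr => hd r hr.1)

end OffDiagonalLimit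

/-! ### Geometry of the domain. -/

section SectorDomain

variable {ρ θ : ℝ}

theorem ofReal_mem_sectorDomain (hρ : 0 < ρ) (t : ℝ) : (t : ℂ) ∈ sectorDomain ρ θ := by
  simp [sectorDomain, hρ]

theorem isOpen_sectorDomain : IsOpen (sectorDomain ρ θ) :=
  isOpen_lt (by fun_prop) (by fun_prop)

theorem starConvex_sectorDomain (hρ : 0 < ρ) : StarConvex ℝ 0 (sectorDomain ρ θ) := by
  rw [starConvex_zero_iff]
  intro x hx a ha0 ha1
  simp only [sectorDomain, Set.mem_ofPred_eq, Complex.smul_re, Complex.smul_im, smul_eq_mul,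
    abs_mul, abs_of_nonneg ha0, lt_max_iff] at hx ⊢
  rcases ha0.eq_or_lt with rfl | ha
  · left; simpa using hρ
  rcases hx with hx | hx
  · left; nlinarith [abs_nonneg x.im]
  · right; nlinarith

theorem isPreconnected_sectorDomain (hρ : 0 < ρ) : IsPreconnected (sectorDomain ρ θ) :=
  ((starConvex_sectorDomain hρ).isPathConnected
    (by simpa using ofReal_mem_sectorDomain (θ := θ) hρ 0)).isConnected.isPreconnected

theorem neg_mem_sectorDomain {x : ℂ} (hx : x ∈ sectorDomain ρ θ) : -x ∈ sectorDomain ρ θ := by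
  simpa [sectorDomain] using hx

/-- The horizontal half-line to the right of `x` stays in the domain, so a solution at `x` can be
compared with its limit at the same height. -/
theorem mem_sectorDomain_of_re_le (hθ : 0 ≤ Real.tan θ) {x : ℂ} (hx : x ∈ sectorDomain ρ θ)
    (h0 : 0 ≤ x.re) {t : ℝ} (ht : x.re ≤ t) : (t + x.im * Complex.I : ℂ) ∈ sectorDomain ρ θ := by
  simp only [sectorDomain, Set.mem_ofPred_eq, Complex.add_im, Complex.ofReal_im, Complex.mul_im,
    Complex.ofReal_re, Complex.I_im, Complex.I_re, Complex.add_re, Complex.mul_re] at hx ⊢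
  refine lt_of_lt_of_le (by simpa using hx) (max_le_max le_rfl ?_)
  refine mul_le_mul_of_nonneg_left ?_ hθ
  rw [abs_of_nonneg h0, mul_zero, zero_mul, sub_zero, add_zero, abs_of_nonneg (h0.trans ht)]
  exact ht

/-- Far to the right, the vertical segment from the real axis to height `y` lies in the domain;
limits are carried across it. -/
theorem eventually_mem_sectorDomain (hθ : 0 < Real.tan θ) (y : ℝ) :
    ∀ᶠ t : ℝ in atTop, ∀ s ∈ Set.Icc (0 : ℝ) 1,
      (t + (s * y : ℝ) * Complex.I : ℂ) ∈ sectorDomain ρ θ := by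
  filter_upwards [eventually_gt_atTop (|y| / Real.tan θ), eventually_ge_atTop 0] with t ht h0 s hs
  have h1 : |s * y| ≤ |y| := by
    rw [abs_mul, abs_of_nonneg hs.1]
    exact mul_le_of_le_one_left (abs_nonneg y) hs.2
  rw [div_lt_iff₀ hθ] at ht
  simp only [sectorDomain, Set.mem_ofPred_eq, lt_max_iff]
  right
  have h2 : (t + (s * y : ℝ) * Complex.I : ℂ).im = s * y := by simp
  have h3 : (t + (s * y : ℝ) * Complex.I : ℂ).re = t := by simp
  rw [h2, h3, abs_of_nonneg h0]
  linarith

theorem tendsto_ofReal_rightEnd (hρ : 0 < ρ) :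
    Tendsto (fun t : ℝ => (t : ℂ)) atTop (rightEnd (sectorDomain ρ θ)) :=
  tendsto_inf.2 ⟨tendsto_comap_iff.2 (by simp only [Function.comp_def, Complex.ofReal_re]; exact tendsto_id),
    tendsto_principal.2 (Eventually.of_forall fun t => ofReal_mem_sectorDomain hρ t)⟩

theorem tendsto_neg_leftEnd :
    Tendsto (fun x : ℂ => -x) (leftEnd (sectorDomain ρ θ)) (rightEnd (sectorDomain ρ θ)) := by
  refine tendsto_inf.2 ⟨tendsto_comap_iff.2 ?_, ?_⟩
  · exact (tendsto_neg_atBot_atTop.comp (tendsto_comap (f := Complex.re))).mono_left inf_le_left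
  · exact tendsto_principal.2 (mem_inf_of_right fun x hx => neg_mem_sectorDomain hx)

end SectorDomain

/-! ### Rotated components and their asymptotics at the right end. -/

/-- The function `e^{ikx} f(x)`. -/
noncomputable def rotate (k : ℝ) (f : ℂ → ℂ) (x : ℂ) : ℂ := Complex.exp (Complex.I * k * x) * f x

section Rotate

variable {B : ℂ → ℂ} {k : ℝ} {U : Set ℂ} {f g : ℂ → ℂ}

/-- This symmetry reduces every statement about the second component to the first. -/
theorem IsDiracPair.swap (h : IsDiracPair B k U f g) :
    IsDiracPair (fun x => -B x) (-k) U g f := by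
  intro x hx
  refine ⟨(h x hx).2.congr_deriv ?_, (h x hx).1.congr_deriv ?_⟩ <;> push_cast <;> ring

theorem IsDiracPair.hasDerivAt_rotate (h : IsDiracPair B k U f g) {x : ℂ} (hx : x ∈ U) :
    HasDerivAt (rotate k f) (B x * Complex.exp (2 * (Complex.I * k * x)) * rotate (-k) g x) x := by
  have h1 : HasDerivAt (fun x : ℂ => Complex.exp (Complex.I * k * x))
      (Complex.exp (Complex.I * k * x) * (Complex.I * k)) x := by
    simpa using ((hasDerivAt_id x).const_mul (Complex.I * (k : ℂ))).cexp
  refine (h1.mul (h x hx).1).congr_deriv ?_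
  have h2 : Complex.exp (2 * (Complex.I * k * x)) * Complex.exp (Complex.I * (-k : ℝ) * x) =
      Complex.exp (Complex.I * k * x) := by
    rw [← Complex.exp_add]; congr 1; push_cast; ring
  unfold rotate
  linear_combination (-(B x * g x)) * h2

theorem IsDiracPair.hasDerivAt_rotate_neg (h : IsDiracPair B k U f g) {x : ℂ} (hx : x ∈ U) :
    HasDerivAt (rotate (-k) g)
      (-(B x * Complex.exp (-(2 * (Complex.I * k * x)))) * rotate k f x) x := by
  refine (h.swap.hasDerivAt_rotate hx).congr_deriv ?_
  push_cast
  rw [neg_neg]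
  ring_nf

theorem norm_cexp_I_mul (k : ℝ) (x : ℂ) :
    ‖Complex.exp (Complex.I * k * x)‖ = Real.exp (-(k * x.im)) := by
  rw [Complex.norm_exp]
  congr 1
  simp [mul_assoc]

/-- Along a horizontal line the rescaled rotated components solve an off-diagonal system whose
coefficients have the modulus of `B`. -/
theorem IsDiracPair.horizontal (h : IsDiracPair B k U f g) {y t : ℝ}
    (hx : (t + y * Complex.I : ℂ) ∈ U) :
    ∃ c : ℂ, ‖c‖ = ‖B (t + y * Complex.I)‖ ∧
      HasDerivAt (fun t : ℝ => (Real.exp (k * y) : ℂ) * rotate k f (t + y * Complex.I))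
        (c * ((Real.exp (-(k * y)) : ℂ) * rotate (-k) g (t + y * Complex.I))) t := by
  have hpath : HasDerivAt (fun t : ℝ => (t + y * Complex.I : ℂ)) 1 t :=
    (Complex.ofRealCLM.hasDerivAt (x := t)).add_const _
  -- At height `y` the factor `e^{2ikx}` has modulus `e^{-2ky}`, which the weights compensate
  -- exactly.
  refine ⟨Real.exp (k * y) ^ 2 * (B (t + y * Complex.I) *
    Complex.exp (2 * (Complex.I * k * (t + y * Complex.I)))), ?_, ?_⟩
  · have : Complex.exp (2 * (Complex.I * k * (t + y * Complex.I))) =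
        Complex.exp (Complex.I * k * (t + y * Complex.I)) ^ 2 := by
      rw [← Complex.exp_nat_mul]; norm_num
    rw [this, norm_mul, norm_mul, norm_pow, norm_pow, norm_cexp_I_mul, Complex.norm_real,
      Real.norm_of_nonneg (Real.exp_pos _).le]
    have him : (t + y * Complex.I : ℂ).im = y := by simp
    rw [him, Real.exp_neg]
    field_simp
  · refine (((h.hasDerivAt_rotate hx).scomp t hpath).const_mul _).congr_deriv ?_
    simp only [smul_eq_mul, one_mul]
    have : (Real.exp (k * y) : ℂ) * Real.exp (-(k * y)) = 1 := by
      rw [← Complex.ofReal_mul, ← Real.exp_add]; simp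
    linear_combination (-(Real.exp (k * y) * (B (t + y * Complex.I) *
      Complex.exp (2 * (Complex.I * k * (t + y * Complex.I))) *
        rotate (-k) g (t + y * Complex.I)))) * this

end Rotate

/-- `B` decays like `(Re x)^{-1-τ}` at the right end of the sector domain. -/
structure RightDecay (B : ℂ → ℂ) (ρ θ C τ R : ℝ) : Prop where
  rho_pos : 0 < ρ
  tan_pos : 0 < Real.tan θ
  const_nonneg : 0 ≤ C
  tau_pos : 0 < τ
  R_pos : 0 < R
  bound : ∀ x ∈ sectorDomain ρ θ, R ≤ x.re → ‖B x‖ ≤ C * x.re ^ (-1 - τ)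

theorem hasDerivAt_rpow_antideriv {C τ t : ℝ} (hτ : 0 < τ) (ht : 0 < t) :
    HasDerivAt (fun t : ℝ => -(C / τ) * t ^ (-τ)) (C * t ^ (-1 - τ)) t := by
  refine ((Real.hasDerivAt_rpow_const (Or.inl ht.ne')).const_mul (-(C / τ))).congr_deriv ?_
  rw [show -τ - 1 = -1 - τ by ring]
  field_simp

theorem tendsto_rpow_antideriv {C τ : ℝ} (hτ : 0 < τ) :
    Tendsto (fun t : ℝ => -(C / τ) * t ^ (-τ)) atTop (𝓝 0) := by
  simpa using (tendsto_rpow_neg_atTop hτ).const_mul (-(C / τ))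

section RightEnd

variable {B : ℂ → ℂ} {ρ θ C τ R k : ℝ} {f g : ℂ → ℂ}

theorem RightDecay.neg (hB : RightDecay B ρ θ C τ R) :
    RightDecay (fun x => -B x) ρ θ C τ R :=
  { hB with bound := by simpa using hB.bound }

theorem RightDecay.exists_tendsto_rotate (hB : RightDecay B ρ θ C τ R)
    (h : IsDiracPair B k (sectorDomain ρ θ) f g) :
    ∃ c, Tendsto (fun t : ℝ => rotate k f t) atTop (𝓝 c) := by
  have hmem : ∀ t : ℝ, (t : ℂ) ∈ sectorDomain ρ θ := ofReal_mem_sectorDomain hB.rho_pos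
  have hn : ∀ t : ℝ, ‖Complex.exp (2 * (Complex.I * k * t))‖ = 1 := fun t => by
    have := norm_cexp_I_mul (2 * k) t
    simp only [Complex.ofReal_im, mul_zero, neg_zero, Real.exp_zero] at this
    rw [← this]; congr 2; push_cast; ring
  have hn' : ∀ t : ℝ, ‖Complex.exp (-(2 * (Complex.I * k * t)))‖ = 1 := fun t => by
    rw [Complex.exp_neg, norm_inv, hn, inv_one]
  have hb : ∀ t ≥ R, ‖B t‖ ≤ C * t ^ (-1 - τ) := fun t ht => hB.bound t (hmem t) (by simpa using ht)
  exact exists_tendsto_offDiagonal (R := R) (v := fun t : ℝ => rotate (-k) g t)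
    (c := fun t => B t * Complex.exp (2 * (Complex.I * k * t)))
    (d := fun t => -(B t * Complex.exp (-(2 * (Complex.I * k * t)))))
    (fun t _ => (h.hasDerivAt_rotate (hmem t)).comp_ofReal)
    (fun t _ => (h.hasDerivAt_rotate_neg (hmem t)).comp_ofReal)
    (fun t ht => hasDerivAt_rpow_antideriv hB.tau_pos (hB.R_pos.trans_le ht))
    (fun t ht => by rw [norm_mul, hn, mul_one]; exact hb t ht)
    (fun t ht => by rw [norm_neg, norm_mul, hn', mul_one]; exact hb t ht)
    (tendsto_rpow_antideriv hB.tau_pos)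

/-- Along the vertical segment from `t` to `t + iy` the off-diagonal coefficients are at most `|y|
e^{2|k||y|} C t^{-1-τ}`. For fixed `y` this tends to `0`, so the limit on the line equals the limit
on the real axis. -/
theorem RightDecay.tendsto_rotate_line (hB : RightDecay B ρ θ C τ R)
    (h : IsDiracPair B k (sectorDomain ρ θ) f g) {c d : ℂ}
    (hc : Tendsto (fun t : ℝ => rotate k f t) atTop (𝓝 c))
    (hd : Tendsto (fun t : ℝ => rotate (-k) g t) atTop (𝓝 d)) (y : ℝ) :
    Tendsto (fun t : ℝ => rotate k f (t + y * Complex.I)) atTop (𝓝 c) := by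
  set K := |y| * Real.exp (2 * |k| * |y|) with hK
  set w : ℝ → ℝ := fun t => K * (C * t ^ (-1 - τ)) with hw
  have hw0 : Tendsto w atTop (𝓝 0) := by
    have h1 : Tendsto (fun t : ℝ => t ^ (-(1 + τ))) atTop (𝓝 0) :=
      tendsto_rpow_neg_atTop (by linarith [hB.tau_pos])
    simp only [neg_add'] at h1
    simpa using (h1.const_mul C).const_mul K
  have hbd : Tendsto (fun t : ℝ => √(‖rotate k f t‖ ^ 2 + ‖rotate (-k) g t‖ ^ 2) *
      Real.exp (w t) * w t) atTop (𝓝 0) := by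
    simpa using ((((hc.norm.pow 2).add (hd.norm.pow 2)).sqrt).mul hw0.rexp).mul hw0
  have hsub : Tendsto (fun t : ℝ => rotate k f (t + y * Complex.I) - rotate k f t) atTop (𝓝 0) := by
    refine squeeze_zero_norm' ?_ hbd
    filter_upwards [eventually_mem_sectorDomain hB.tan_pos y, eventually_ge_atTop R] with t hm hR
    have hpath : ∀ s : ℝ, HasDerivAt (fun s : ℝ => (t + (s * y : ℝ) * Complex.I : ℂ))
        (y * Complex.I) s := fun s => by
      have := (((hasDerivAt_id s).mul_const y).ofReal_comp.mul_const Complex.I).const_add (t : ℂ)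
      simpa using this
    have hre : ∀ s : ℝ, (t + (s * y : ℝ) * Complex.I : ℂ).re = t := fun s => by simp
    have hexp : ∀ q : ℝ, |q| = 2 * |k| → ∀ s ∈ Set.Icc (0 : ℝ) 1,
        ‖Complex.exp (Complex.I * q * (t + (s * y : ℝ) * Complex.I))‖ ≤
          Real.exp (2 * |k| * |y|) := by
      intro q hq s hs
      rw [norm_cexp_I_mul]
      refine Real.exp_le_exp.2 ((neg_le_abs _).trans ?_)
      have him : (t + (s * y : ℝ) * Complex.I : ℂ).im = s * y := by simp
      rw [him, abs_mul, hq, abs_mul, abs_of_nonneg hs.1]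
      gcongr
      exact mul_le_of_le_one_left (abs_nonneg y) hs.2
    have hcoef : ∀ q : ℝ, |q| = 2 * |k| → ∀ s ∈ Set.Icc (0 : ℝ) 1,
        ‖(y * Complex.I : ℂ) * (B (t + (s * y : ℝ) * Complex.I) *
          Complex.exp (Complex.I * q * (t + (s * y : ℝ) * Complex.I)))‖ ≤ w t := by
      intro q hq s hs
      have h1 := hB.bound _ (hm s hs) (by rw [hre]; exact hR)
      rw [hre] at h1
      rw [norm_mul, norm_mul, norm_mul, Complex.norm_I, mul_one, Complex.norm_real,
        Real.norm_eq_abs]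
      calc |y| * (_ * _) ≤ |y| * ((C * t ^ (-1 - τ)) * Real.exp (2 * |k| * |y|)) := by
            gcongr
            · exact (norm_nonneg _).trans h1
            · exact hexp q hq s hs
        _ = w t := by simp only [hw, hK]; ring
    have := offDiagonal_norm_sub_le (a := 0) (b := 1) zero_le_one
      (u := fun s : ℝ => rotate k f (t + (s * y : ℝ) * Complex.I))
      (v := fun s : ℝ => rotate (-k) g (t + (s * y : ℝ) * Complex.I))
      (c := fun s => (y * Complex.I : ℂ) * (B (t + (s * y : ℝ) * Complex.I) *
          Complex.exp (Complex.I * (2 * k : ℝ) * (t + (s * y : ℝ) * Complex.I))))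
      (d := fun s => -((y * Complex.I : ℂ) * (B (t + (s * y : ℝ) * Complex.I) *
          Complex.exp (Complex.I * (-2 * k : ℝ) * (t + (s * y : ℝ) * Complex.I)))))
      (P := fun s => s * w t) (p := fun _ => w t)
      (fun s hs => by
        refine ((h.hasDerivAt_rotate (hm s hs)).scomp s (hpath s)).congr_deriv ?_
        rw [smul_eq_mul]
        push_cast
        ring_nf)
      (fun s hs => by
        refine ((h.hasDerivAt_rotate_neg (hm s hs)).scomp s (hpath s)).congr_deriv ?_
        rw [smul_eq_mul]
        push_cast
        ring_nf)
      (fun s _ => by simpa using (hasDerivAt_id s).mul_const (w t))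
      (fun s hs => hcoef _ (by rw [abs_mul]; simp) s hs)
      (fun s hs => by
        rw [norm_neg]
        exact hcoef _ (by rw [abs_mul]; simp) s hs)
    simpa using this
  simpa using hsub.add hc

/-- The off-diagonal estimate is applied on the horizontal half-line issuing from `x`. The weights
`e^{±k Im x}` make the error factor depend on `Re x` alone, so heights may be unbounded as they are
in the sectors. -/
theorem RightDecay.norm_rotate_sub_le (hB : RightDecay B ρ θ C τ R)
    (h : IsDiracPair B k (sectorDomain ρ θ) f g) {c d : ℂ}
    (hc : Tendsto (fun t : ℝ => rotate k f t) atTop (𝓝 c))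
    (hd : Tendsto (fun t : ℝ => rotate (-k) g t) atTop (𝓝 d)) {x : ℂ}
    (hx : x ∈ sectorDomain ρ θ) (hR : R ≤ x.re) :
    ‖Real.exp (k * x.im) * rotate k f x - Real.exp (k * x.im) * c‖ ≤
      √(‖Real.exp (k * x.im) * c‖ ^ 2 + ‖Real.exp (-(k * x.im)) * d‖ ^ 2) *
        Real.exp (C / τ * x.re ^ (-τ)) * (C / τ * x.re ^ (-τ)) := by
  set y := x.im
  have hmem : ∀ t ≥ x.re, (t + y * Complex.I : ℂ) ∈ sectorDomain ρ θ := fun t ht =>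
    mem_sectorDomain_of_re_le hB.tan_pos.le hx (hB.R_pos.le.trans hR) ht
  have hb : ∀ t ≥ x.re, ‖B (t + y * Complex.I)‖ ≤ C * t ^ (-1 - τ) := fun t ht => by
    have hre : (t + y * Complex.I : ℂ).re = t := by simp
    have := hB.bound _ (hmem t ht) (by rw [hre]; exact hR.trans ht)
    rwa [hre] at this
  have key1 : ∀ t ≥ x.re, ∃ c : ℂ, ‖c‖ ≤ C * t ^ (-1 - τ) ∧
      HasDerivAt (fun t : ℝ => (Real.exp (k * y) : ℂ) * rotate k f (t + y * Complex.I))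
        (c * ((Real.exp (-(k * y)) : ℂ) * rotate (-k) g (t + y * Complex.I))) t := fun t ht => by
    obtain ⟨c, h1, h2⟩ := h.horizontal (hmem t ht)
    exact ⟨c, h1.trans_le (hb t ht), h2⟩
  have key2 : ∀ t ≥ x.re, ∃ c : ℂ, ‖c‖ ≤ C * t ^ (-1 - τ) ∧
      HasDerivAt (fun t : ℝ => (Real.exp (-(k * y)) : ℂ) * rotate (-k) g (t + y * Complex.I))
        (c * ((Real.exp (k * y) : ℂ) * rotate k f (t + y * Complex.I))) t := fun t ht => by
    obtain ⟨c, h1, h2⟩ := h.swap.horizontal (hmem t ht)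
    rw [norm_neg] at h1
    refine ⟨c, h1.trans_le (hb t ht), ?_⟩
    simpa only [neg_mul, neg_neg] using h2
  choose! c1 hc1 hd1 using key1
  choose! c2 hc2 hd2 using key2
  have hlim1 := (hB.tendsto_rotate_line h hc hd y).const_mul (Real.exp (k * y) : ℂ)
  have hlim2 := (hB.neg.tendsto_rotate_line h.swap hd (by simpa using hc) y).const_mul
    (Real.exp (-(k * y)) : ℂ)
  have := norm_sub_limit_offDiagonal_le (R := x.re) hd1 hd2
    (fun t ht => hasDerivAt_rpow_antideriv (C := C) hB.tau_pos (hB.R_pos.trans_le (hR.trans ht)))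
    hc1 hc2 (tendsto_rpow_antideriv hB.tau_pos) hlim1 hlim2
  simp only [y, Complex.re_add_im, neg_mul, neg_neg] at this
  simpa only [y] using this

theorem rotate_eq_exp_mul_rotate (k : ℝ) (f : ℂ → ℂ) (x : ℂ) :
    rotate (-k) f x = Complex.exp (-(2 * (Complex.I * k * x))) * rotate k f x := by
  unfold rotate
  rw [← mul_assoc, ← Complex.exp_add]
  congr 2
  push_cast
  ring

theorem tendsto_error_rightEnd (hτ : 0 < τ) (K : ℝ) :
    Tendsto (fun x : ℂ => K * Real.exp (C / τ * x.re ^ (-τ)) * (C / τ * x.re ^ (-τ)))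
      (rightEnd (sectorDomain ρ θ)) (𝓝 0) := by
  have h1 : Tendsto (fun t : ℝ => C / τ * t ^ (-τ)) atTop (𝓝 0) := by
    simpa using (tendsto_rpow_neg_atTop hτ).const_mul (C / τ)
  have h2 : Tendsto (fun t : ℝ => K * Real.exp (C / τ * t ^ (-τ)) * (C / τ * t ^ (-τ)))
      atTop (𝓝 0) := by
    simpa using (h1.rexp.const_mul K).mul h1
  exact h2.comp (tendsto_comap.mono_left inf_le_left)

/-- A solution whose rotated components tend to `(0, d)` along the real axis is
`e^{ikx} ((0, d) + o(1))` in the whole right end of the sector domain. -/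
theorem RightDecay.tendsto_rightEnd (hB : RightDecay B ρ θ C τ R)
    (h : IsDiracPair B k (sectorDomain ρ θ) f g) {d : ℂ}
    (hc : Tendsto (fun t : ℝ => rotate k f t) atTop (𝓝 0))
    (hd : Tendsto (fun t : ℝ => rotate (-k) g t) atTop (𝓝 d)) :
    Tendsto (rotate (-k) f) (rightEnd (sectorDomain ρ θ)) (𝓝 0) ∧
      Tendsto (rotate (-k) g) (rightEnd (sectorDomain ρ θ)) (𝓝 d) := by
  have hev : ∀ᶠ x in rightEnd (sectorDomain ρ θ), x ∈ sectorDomain ρ θ ∧ R ≤ x.re := by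
    refine (eventually_inf_principal.2 (Eventually.of_forall fun x hx => hx)).and ?_
    exact (tendsto_comap.eventually (eventually_ge_atTop R)).filter_mono inf_le_left
  have herr := tendsto_error_rightEnd (ρ := ρ) (θ := θ) (C := C) hB.tau_pos ‖d‖
  constructor
  · refine squeeze_zero_norm' ?_ herr
    filter_upwards [hev] with x ⟨hx, hR⟩
    have h1 := hB.norm_rotate_sub_le h hc hd hx hR
    have h2 : ‖Complex.exp (-(2 * (Complex.I * k * x)))‖ = Real.exp (k * x.im) ^ 2 := by
      have := norm_cexp_I_mul (-(2 * k)) x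
      rw [show Complex.I * (-(2 * k) : ℝ) * x = -(2 * (Complex.I * k * x)) by push_cast; ring]
        at this
      rw [this, ← Real.exp_nat_mul]
      congr 1
      push_cast
      ring
    rw [rotate_eq_exp_mul_rotate, norm_mul, h2]
    simp only [mul_zero, sub_zero, norm_zero, norm_mul, Complex.norm_real,
      Real.norm_of_nonneg (Real.exp_pos _).le] at h1
    -- Because the first limit vanishes, the right side carries `e^{-k Im x}`; this absorbs the
    -- additional `e^{k Im x}` in the modulus of `e^{-ikx} f`.
    rw [zero_pow two_ne_zero, zero_add, Real.sqrt_sq (by positivity), Real.exp_neg] at h1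
    have h3 := mul_le_mul_of_nonneg_left h1 (Real.exp_pos (k * x.im)).le
    have h4 : Real.exp (k * x.im) * (Real.exp (k * x.im))⁻¹ = 1 :=
      mul_inv_cancel₀ (Real.exp_pos _).ne'
    calc _ = Real.exp (k * x.im) * (Real.exp (k * x.im) * ‖rotate k f x‖) := by ring
      _ ≤ _ := h3
      _ = (Real.exp (k * x.im) * (Real.exp (k * x.im))⁻¹) * (‖d‖ *
          Real.exp (C / τ * x.re ^ (-τ)) * (C / τ * x.re ^ (-τ))) := by ring
      _ = _ := by rw [h4, one_mul]
  · rw [tendsto_iff_norm_sub_tendsto_zero]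
    refine squeeze_zero' (Eventually.of_forall fun x => norm_nonneg _) ?_ herr
    filter_upwards [hev] with x ⟨hx, hR⟩
    have h1 := hB.neg.norm_rotate_sub_le h.swap hd (by simpa using hc) hx hR
    simp only [mul_zero, norm_zero, ← mul_sub, norm_mul, Complex.norm_real,
      Real.norm_of_nonneg (Real.exp_pos _).le] at h1
    rw [zero_pow two_ne_zero, add_zero, Real.sqrt_sq (by positivity)] at h1
    have h3 := Real.exp_pos (-k * x.im)
    refine le_of_mul_le_mul_left (h1.trans_eq ?_) h3
    ring

end RightEnd

/-! ### Solutions parametrised by their limits on the real axis. -/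

/-- The components `(f, g)`, rotated by `e^{± ikt}`, tend to `(c, d)` along the real axis. -/
def HasRealLimit (k : ℝ) (l : Filter ℝ) (f g : ℂ → ℂ) (c d : ℂ) : Prop :=
  Tendsto (fun t : ℝ => rotate k f t) l (𝓝 c) ∧ Tendsto (fun t : ℝ => rotate (-k) g t) l (𝓝 d)

section RealLimit

variable {B : ℂ → ℂ} {k : ℝ} {l : Filter ℝ} {f g f₁ g₁ f₂ g₂ : ℂ → ℂ} {c d c₁ d₁ c₂ d₂ : ℂ}
  {ρ θ C τ R : ℝ}

theorem rotate_comp_neg (k : ℝ) (f : ℂ → ℂ) (x : ℂ) :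
    rotate k (fun x => f (-x)) x = rotate (-k) f (-x) := by
  unfold rotate
  congr 2
  push_cast
  ring

theorem rotate_mul_rotate_neg (k : ℝ) (f g : ℂ → ℂ) (x : ℂ) :
    rotate k f x * rotate (-k) g x = f x * g x := by
  have : Complex.exp (Complex.I * k * x) * Complex.exp (Complex.I * (-k : ℝ) * x) = 1 := by
    rw [← Complex.exp_add, ← Complex.exp_zero]; congr 1; push_cast; ring
  unfold rotate
  linear_combination (f x * g x) * this

theorem HasRealLimit.swap (h : HasRealLimit k l f g c d) : HasRealLimit (-k) l g f d c :=
  ⟨h.2, by simpa using h.1⟩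

theorem HasRealLimit.comp_neg {l' : Filter ℝ} (h : HasRealLimit k l f g c d)
    (hl : Tendsto (fun t : ℝ => -t) l' l) :
    HasRealLimit (-k) l' (fun x => f (-x)) (fun x => g (-x)) c d := by
  refine ⟨(h.1.comp hl).congr fun t => ?_, (h.2.comp hl).congr fun t => ?_⟩ <;>
    simp [rotate_comp_neg]

theorem HasRealLimit.linear_combination (h₁ : HasRealLimit k l f₁ g₁ c₁ d₁)
    (h₂ : HasRealLimit k l f₂ g₂ c₂ d₂) (a b : ℂ) :
    HasRealLimit k l (fun x => a * f₁ x + b * f₂ x) (fun x => a * g₁ x + b * g₂ x)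
      (a * c₁ + b * c₂) (a * d₁ + b * d₂) := by
  refine ⟨((h₁.1.const_mul a).add (h₂.1.const_mul b)).congr fun t => ?_,
    ((h₁.2.const_mul a).add (h₂.2.const_mul b)).congr fun t => ?_⟩ <;> unfold rotate <;> ring

/-- The opposite rotations cancel in each product of the Wronskian, and the Wronskian is constant,
so its value can be read off at the end. -/
theorem wronskian_eq_of_hasRealLimit [l.NeBot] (hρ : 0 < ρ)
    (h₁ : IsDiracPair B k (sectorDomain ρ θ) f₁ g₁) (h₂ : IsDiracPair B k (sectorDomain ρ θ) f₂ g₂)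
    (hl₁ : HasRealLimit k l f₁ g₁ c₁ d₁) (hl₂ : HasRealLimit k l f₂ g₂ c₂ d₂) :
    pairWronskian f₁ g₁ f₂ g₂ 0 = c₁ * d₂ - d₁ * c₂ := by
  have h0 : (0 : ℂ) ∈ sectorDomain ρ θ := by
    simpa using ofReal_mem_sectorDomain (θ := θ) hρ 0
  have hlim := (hl₁.1.mul hl₂.2).sub (hl₁.2.mul hl₂.1)
  refine tendsto_nhds_unique (tendsto_const_nhds.congr fun t => ?_) hlim
  rw [h₁.wronskian_eq h₂ isOpen_sectorDomain (isPreconnected_sectorDomain hρ) h0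
    (ofReal_mem_sectorDomain hρ t), mul_comm (rotate (-k) g₁ t), rotate_mul_rotate_neg,
    rotate_mul_rotate_neg, pairWronskian, mul_comm (f₂ _)]

theorem RightDecay.hasRealLimit (hB : RightDecay B ρ θ C τ R)
    (h : IsDiracPair B k (sectorDomain ρ θ) f g) : ∃ c d, HasRealLimit k atTop f g c d := by
  obtain ⟨c, hc⟩ := hB.exists_tendsto_rotate h
  obtain ⟨d, hd⟩ := hB.neg.exists_tendsto_rotate h.swap
  exact ⟨c, d, hc, hd⟩

/-- Solutions with prescribed real limits at `+∞` exist. -/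
theorem RightDecay.exists_pair (hB : RightDecay B ρ θ C τ R)
    (hd : DifferentiableOn ℂ B (sectorDomain ρ θ)) (k : ℝ) (c d : ℂ) :
    ∃ f g, IsDiracPair B k (sectorDomain ρ θ) f g ∧ HasRealLimit k atTop f g c d := by
  obtain ⟨f₁, g₁, hf₁, hg₁, h₁⟩ := exists_isDiracPair k isOpen_sectorDomain
    (starConvex_sectorDomain hB.rho_pos) hd 1 0
  obtain ⟨f₂, g₂, hf₂, hg₂, h₂⟩ := exists_isDiracPair k isOpen_sectorDomain
    (starConvex_sectorDomain hB.rho_pos) hd 0 1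
  obtain ⟨c₁, d₁, hl₁⟩ := hB.hasRealLimit h₁
  obtain ⟨c₂, d₂, hl₂⟩ := hB.hasRealLimit h₂
  have hw := wronskian_eq_of_hasRealLimit hB.rho_pos h₁ h₂ hl₁ hl₂
  simp only [pairWronskian, hf₁, hg₂, hg₁, hf₂, mul_one, mul_zero, sub_zero] at hw
  -- Cramer's rule; the determinant `c₁ d₂ - d₁ c₂` equals the Wronskian of the initial data at `0`,
  -- which is `1`.
  refine ⟨_, _, h₁.linear_combination h₂ (c * d₂ - d * c₂) (d * c₁ - c * d₁), ?_⟩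
  convert hl₁.linear_combination hl₂ (c * d₂ - d * c₂) (d * c₁ - c * d₁) using 1
  · linear_combination c * hw
  · linear_combination d * hw

theorem IsDiracPair.comp_neg_sectorDomain (h : IsDiracPair B k (sectorDomain ρ θ) f g) :
    IsDiracPair (fun x => -B (-x)) (-k) (sectorDomain ρ θ) (fun x => f (-x)) (fun x => g (-x)) :=
  h.comp_neg fun _ hx => neg_mem_sectorDomain hx

/-- Solutions with prescribed real limits at `-∞` exist. -/
theorem RightDecay.exists_pair_left (hB : RightDecay (fun x => -B (-x)) ρ θ C τ R)
    (hd : DifferentiableOn ℂ B (sectorDomain ρ θ)) (k : ℝ) (c d : ℂ) :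
    ∃ f g, IsDiracPair B k (sectorDomain ρ θ) f g ∧ HasRealLimit k atBot f g c d := by
  have hd' : DifferentiableOn ℂ (fun x => -B (-x)) (sectorDomain ρ θ) :=
    (hd.comp differentiableOn_id.neg fun x hx => neg_mem_sectorDomain hx).neg
  obtain ⟨f, g, h, hl⟩ := hB.exists_pair hd' (-k) c d
  exact ⟨fun x => f (-x), fun x => g (-x), by simpa using h.comp_neg_sectorDomain,
    by simpa using hl.comp_neg tendsto_neg_atBot_atTop⟩

theorem tendsto_rotate_neg_of_zero (hf : Tendsto (fun t : ℝ => rotate (-k) f t) l (𝓝 0)) :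
    Tendsto (fun t : ℝ => rotate k f t) l (𝓝 0) := by
  rw [tendsto_zero_iff_norm_tendsto_zero] at hf ⊢
  refine hf.congr fun t => ?_
  simp only [rotate, norm_mul, norm_cexp_I_mul]
  simp

/-- The Jost condition rotates both components by the same exponential, the real limits by opposite
ones. On the real axis the exponentials have modulus one, so for a component tending to `0` the
difference is immaterial; the passage to the sectors is `RightDecay.tendsto_rightEnd`. -/
theorem RightDecay.jostPlus_iff (hB : RightDecay B ρ θ C τ R)
    (h : IsDiracPair B k (sectorDomain ρ θ) f g) :
    (Tendsto (rotate (-k) f) (rightEnd (sectorDomain ρ θ)) (𝓝 0) ∧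
      Tendsto (rotate (-k) g) (rightEnd (sectorDomain ρ θ)) (𝓝 d)) ↔
      HasRealLimit k atTop f g 0 d :=
  ⟨fun ht => ⟨tendsto_rotate_neg_of_zero (ht.1.comp (tendsto_ofReal_rightEnd hB.rho_pos)),
    ht.2.comp (tendsto_ofReal_rightEnd hB.rho_pos)⟩,
    fun hl => hB.tendsto_rightEnd h hl.1 hl.2⟩

theorem RightDecay.jostMinus_iff (hB : RightDecay B ρ θ C τ R)
    (h : IsDiracPair B k (sectorDomain ρ θ) f g) :
    (Tendsto (rotate k f) (rightEnd (sectorDomain ρ θ)) (𝓝 c) ∧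
      Tendsto (rotate k g) (rightEnd (sectorDomain ρ θ)) (𝓝 0)) ↔
      HasRealLimit k atTop f g c 0 := by
  have := hB.neg.jostPlus_iff (d := c) h.swap
  rw [neg_neg, and_comm] at this
  exact this.trans ⟨fun h => by simpa using h.swap, fun h => h.swap⟩

theorem tendsto_rotate_leftEnd_iff {L : ℂ} : Tendsto (rotate k f) (leftEnd (sectorDomain ρ θ)) (𝓝 L) ↔
    Tendsto (rotate (-k) fun x => f (-x)) (rightEnd (sectorDomain ρ θ)) (𝓝 L) := by
  have hneg : Tendsto (fun x : ℂ => -x) (rightEnd (sectorDomain ρ θ))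
      (leftEnd (sectorDomain ρ θ)) := by
    refine tendsto_inf.2 ⟨tendsto_comap_iff.2 ?_, ?_⟩
    · exact (tendsto_neg_atTop_atBot.comp (tendsto_comap (f := Complex.re))).mono_left inf_le_left
    · exact tendsto_principal.2 (mem_inf_of_right fun x hx => neg_mem_sectorDomain hx)
  constructor
  · exact fun h => (h.comp hneg).congr fun x => by simp [rotate_comp_neg]
  · exact fun h => (h.comp tendsto_neg_leftEnd).congr fun x => by simp [rotate_comp_neg]

theorem hasRealLimit_atBot_iff : HasRealLimit k atBot f g c d ↔
    HasRealLimit (-k) atTop (fun x => f (-x)) (fun x => g (-x)) c d :=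
  ⟨fun h => h.comp_neg tendsto_neg_atTop_atBot,
    fun h => by simpa using h.comp_neg tendsto_neg_atBot_atTop⟩

theorem RightDecay.jostPlus_left_iff (hB : RightDecay (fun x => -B (-x)) ρ θ C τ R)
    (h : IsDiracPair B k (sectorDomain ρ θ) f g) :
    (Tendsto (rotate (-k) f) (leftEnd (sectorDomain ρ θ)) (𝓝 0) ∧
      Tendsto (rotate (-k) g) (leftEnd (sectorDomain ρ θ)) (𝓝 d)) ↔
      HasRealLimit k atBot f g 0 d := by
  rw [hasRealLimit_atBot_iff, ← hB.jostPlus_iff h.comp_neg_sectorDomain,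
    tendsto_rotate_leftEnd_iff, tendsto_rotate_leftEnd_iff]

theorem RightDecay.jostMinus_left_iff (hB : RightDecay (fun x => -B (-x)) ρ θ C τ R)
    (h : IsDiracPair B k (sectorDomain ρ θ) f g) :
    (Tendsto (rotate k f) (leftEnd (sectorDomain ρ θ)) (𝓝 c) ∧
      Tendsto (rotate k g) (leftEnd (sectorDomain ρ θ)) (𝓝 0)) ↔
      HasRealLimit k atBot f g c 0 := by
  rw [hasRealLimit_atBot_iff, ← hB.jostMinus_iff h.comp_neg_sectorDomain,
    tendsto_rotate_leftEnd_iff, tendsto_rotate_leftEnd_iff]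

/-- In a part of the right end of bounded imaginary part the limits on the real axis persist. -/
theorem RightDecay.tendsto_rotate_strip (hB : RightDecay B ρ θ C τ R)
    (h : IsDiracPair B k (sectorDomain ρ θ) f g) (hl : HasRealLimit k atTop f g c d) (M : ℝ) :
    Tendsto (rotate k f) (rightEnd (sectorDomain ρ θ) ⊓ 𝓟 {x | |x.im| ≤ M}) (𝓝 c) := by
  set K := Real.exp (|k| * M) * √((Real.exp (|k| * M) * ‖c‖) ^ 2 + (Real.exp (|k| * M) * ‖d‖) ^ 2)
  have herr := (tendsto_error_rightEnd (ρ := ρ) (θ := θ) (C := C) hB.tau_pos K).mono_left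
    (inf_le_left (b := 𝓟 {x : ℂ | |x.im| ≤ M}))
  rw [tendsto_iff_norm_sub_tendsto_zero]
  refine squeeze_zero' (Eventually.of_forall fun x => norm_nonneg _) ?_ herr
  have hev : ∀ᶠ x in rightEnd (sectorDomain ρ θ), x ∈ sectorDomain ρ θ ∧ R ≤ x.re := by
    refine (eventually_inf_principal.2 (Eventually.of_forall fun x hx => hx)).and ?_
    exact (tendsto_comap.eventually (eventually_ge_atTop R)).filter_mono inf_le_left
  refine eventually_inf_principal.2 (hev.mono fun x hx hM => ?_)
  have hM' : |k * x.im| ≤ |k| * M := by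
    rw [abs_mul]; exact mul_le_mul_of_nonneg_left hM (abs_nonneg k)
  have h1 := hB.norm_rotate_sub_le h hl.1 hl.2 hx.1 hx.2
  have hx0 : 0 ≤ x.re := hB.R_pos.le.trans hx.2
  have hCτ : 0 ≤ C / τ * x.re ^ (-τ) := by
    have := hB.const_nonneg; have := hB.tau_pos; positivity
  simp only [← mul_sub, norm_mul, Complex.norm_real, Real.norm_of_nonneg (Real.exp_pos _).le] at h1
  have e1 : Real.exp (k * x.im) ≤ Real.exp (|k| * M) :=
    Real.exp_le_exp.2 ((le_abs_self _).trans hM')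
  have e2 : Real.exp (-(k * x.im)) ≤ Real.exp (|k| * M) :=
    Real.exp_le_exp.2 ((neg_le_abs _).trans hM')
  have h2 := mul_le_mul e2 h1 (by positivity) (Real.exp_pos _).le
  rw [← mul_assoc, ← Real.exp_add, neg_add_cancel, Real.exp_zero, one_mul] at h2
  refine h2.trans ?_
  generalize C / τ * x.re ^ (-τ) = E at hCτ ⊢
  rw [← mul_assoc, ← mul_assoc]
  refine mul_le_mul_of_nonneg_right (mul_le_mul_of_nonneg_right ?_ (Real.exp_pos _).le) hCτ
  simp only [K]
  gcongr

theorem RightDecay.hasRealLimit_strip (hB : RightDecay B ρ θ C τ R)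
    (h : IsDiracPair B k (sectorDomain ρ θ) f g) (hl : HasRealLimit k atTop f g c d) (M : ℝ) :
    Tendsto (rotate k f) (rightEnd (sectorDomain ρ θ) ⊓ 𝓟 {x | |x.im| ≤ M}) (𝓝 c) ∧
    Tendsto (rotate (-k) g) (rightEnd (sectorDomain ρ θ) ⊓ 𝓟 {x | |x.im| ≤ M}) (𝓝 d) :=
  ⟨hB.tendsto_rotate_strip h hl M, hB.neg.tendsto_rotate_strip h.swap hl.swap M⟩

theorem RightDecay.hasRealLimit_strip_left (hB : RightDecay (fun x => -B (-x)) ρ θ C τ R)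
    (h : IsDiracPair B k (sectorDomain ρ θ) f g) (hl : HasRealLimit k atBot f g c d) (M : ℝ) :
    Tendsto (rotate k f) (leftEnd (sectorDomain ρ θ) ⊓ 𝓟 {x | |x.im| ≤ M}) (𝓝 c) ∧
    Tendsto (rotate (-k) g) (leftEnd (sectorDomain ρ θ) ⊓ 𝓟 {x | |x.im| ≤ M}) (𝓝 d) := by
  have hneg : Tendsto (fun x : ℂ => -x) (leftEnd (sectorDomain ρ θ) ⊓ 𝓟 {x | |x.im| ≤ M})
      (rightEnd (sectorDomain ρ θ) ⊓ 𝓟 {x | |x.im| ≤ M}) :=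
    tendsto_neg_leftEnd.inf (tendsto_principal_principal.2 fun x hx => by simpa using hx)
  obtain ⟨h1, h2⟩ := hB.hasRealLimit_strip h.comp_neg_sectorDomain
    (hasRealLimit_atBot_iff.1 hl) M
  exact ⟨(h1.comp hneg).congr fun x => by simp [rotate_comp_neg],
    (h2.comp hneg).congr fun x => by simp [rotate_comp_neg]⟩

/-- A solution is determined by its real limits at one end. -/
theorem eq_of_hasRealLimit [l.NeBot] (hρ : 0 < ρ)
    (hbasis : ∀ c d, ∃ f g, IsDiracPair B k (sectorDomain ρ θ) f g ∧ HasRealLimit k l f g c d)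
    (h₁ : IsDiracPair B k (sectorDomain ρ θ) f₁ g₁) (h₂ : IsDiracPair B k (sectorDomain ρ θ) f₂ g₂)
    (hl₁ : HasRealLimit k l f₁ g₁ c d) (hl₂ : HasRealLimit k l f₂ g₂ c d) {x : ℂ}
    (hx : x ∈ sectorDomain ρ θ) : f₁ x = f₂ x ∧ g₁ x = g₂ x := by
  obtain ⟨fp, gp, hp, hlp⟩ := hbasis 0 1
  obtain ⟨fm, gm, hm, hlm⟩ := hbasis 1 0
  have hd := h₁.linear_combination h₂ 1 (-1)
  have hld := hl₁.linear_combination hl₂ 1 (-1)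
  have h0 : (0 : ℂ) ∈ sectorDomain ρ θ := by
    simpa using ofReal_mem_sectorDomain (θ := θ) hρ 0
  have hw := wronskian_eq_of_hasRealLimit hρ hp hm hlp hlm
  have hexp := hd.expansion hp hm isOpen_sectorDomain (isPreconnected_sectorDomain hρ) h0
    (by rw [hw]; simp) hx
  rw [wronskian_eq_of_hasRealLimit hρ hd hm hld hlm,
    wronskian_eq_of_hasRealLimit hρ hp hd hlp hld] at hexp
  simp only [one_mul, neg_one_mul, ← sub_eq_add_neg, sub_self, zero_mul, mul_zero, zero_div,
    add_zero, sub_eq_zero] at hexp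
  exact hexp

end RealLimit

/-! ### The transition matrix as a scattering map. -/

section Transition

variable {A : ℂ → ℂ} {ρ θ ε lam C τ R C' τ' R' : ℝ} {F : ℂ → Fin 2 → ℂ}

theorem tendsto_exp_smul_iff {l : Filter ℂ} {k : ℝ} {e : ℂ → ℂ} {c d : ℂ}
    (he : ∀ x, e x = Complex.I * k * x) :
    Tendsto (fun x : ℂ => Complex.exp (e x) • F x) l (𝓝 ![c, d]) ↔
      Tendsto (rotate k fun x => F x 0) l (𝓝 c) ∧ Tendsto (rotate k fun x => F x 1) l (𝓝 d) := by
  rw [tendsto_pi_nhds, Fin.forall_fin_two]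
  simp only [he]
  rfl

theorem jostPlus_phase (ε lam : ℝ) (x : ℂ) :
    -(Complex.I * lam * x / ε) = Complex.I * (-(lam / ε) : ℝ) * x := by push_cast; ring

theorem jostMinus_phase (ε lam : ℝ) (x : ℂ) :
    Complex.I * lam * x / ε = Complex.I * (lam / ε : ℝ) * x := by push_cast; ring

theorem isJostPlus_right_iff (hR : RightDecay (fun x => A x / ε) ρ θ C τ R) (hε : ε ≠ 0) :
    IsJostPlus A (sectorDomain ρ θ) (rightEnd (sectorDomain ρ θ)) ε lam F ↔
      IsDiracPair (fun x => A x / ε) (lam / ε) (sectorDomain ρ θ) (fun x => F x 0) (fun x => F x 1) ∧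
      HasRealLimit (lam / ε) atTop (fun x => F x 0) (fun x => F x 1) 0 1 := by
  rw [IsJostPlus, isDiracSolution_iff lam isOpen_sectorDomain hε,
    tendsto_exp_smul_iff (jostPlus_phase ε lam)]
  exact and_congr_right fun h => hR.jostPlus_iff h

theorem isJostMinus_right_iff (hR : RightDecay (fun x => A x / ε) ρ θ C τ R) (hε : ε ≠ 0) :
    IsJostMinus A (sectorDomain ρ θ) (rightEnd (sectorDomain ρ θ)) ε lam F ↔
      IsDiracPair (fun x => A x / ε) (lam / ε) (sectorDomain ρ θ) (fun x => F x 0) (fun x => F x 1) ∧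
      HasRealLimit (lam / ε) atTop (fun x => F x 0) (fun x => F x 1) 1 0 := by
  rw [IsJostMinus, isDiracSolution_iff lam isOpen_sectorDomain hε,
    tendsto_exp_smul_iff (jostMinus_phase ε lam)]
  exact and_congr_right fun h => hR.jostMinus_iff h

theorem isJostPlus_left_iff (hL : RightDecay (fun x => -(A (-x) / ε)) ρ θ C τ R) (hε : ε ≠ 0) :
    IsJostPlus A (sectorDomain ρ θ) (leftEnd (sectorDomain ρ θ)) ε lam F ↔
      IsDiracPair (fun x => A x / ε) (lam / ε) (sectorDomain ρ θ) (fun x => F x 0) (fun x => F x 1) ∧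
      HasRealLimit (lam / ε) atBot (fun x => F x 0) (fun x => F x 1) 0 1 := by
  rw [IsJostPlus, isDiracSolution_iff lam isOpen_sectorDomain hε,
    tendsto_exp_smul_iff (jostPlus_phase ε lam)]
  exact and_congr_right fun h => RightDecay.jostPlus_left_iff hL h

theorem isJostMinus_left_iff (hL : RightDecay (fun x => -(A (-x) / ε)) ρ θ C τ R) (hε : ε ≠ 0) :
    IsJostMinus A (sectorDomain ρ θ) (leftEnd (sectorDomain ρ θ)) ε lam F ↔
      IsDiracPair (fun x => A x / ε) (lam / ε) (sectorDomain ρ θ) (fun x => F x 0) (fun x => F x 1) ∧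
      HasRealLimit (lam / ε) atBot (fun x => F x 0) (fun x => F x 1) 1 0 := by
  rw [IsJostMinus, isDiracSolution_iff lam isOpen_sectorDomain hε,
    tendsto_exp_smul_iff (jostMinus_phase ε lam)]
  exact and_congr_right fun h => RightDecay.jostMinus_left_iff hL h

/-- A solution with real limits `(c, d)` at `-∞` has real limits `(c', d')` at `+∞`. -/
def Scatters (B : ℂ → ℂ) (k : ℝ) (U : Set ℂ) (c d c' d' : ℂ) : Prop :=
  ∃ f g, IsDiracPair B k U f g ∧ HasRealLimit k atBot f g c d ∧ HasRealLimit k atTop f g c' d'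

/-- The solution `f₊` has limits `(0, 1)` and `f₋` has `(1, 0)`, so in limits the coefficient of
`f₊` is the second entry: each column of `T` appears with its entries exchanged. -/
theorem isTransitionMatrix_iff (hR : RightDecay (fun x => A x / ε) ρ θ C τ R)
    (hL : RightDecay (fun x => -(A (-x) / ε)) ρ θ C' τ' R')
    (hA : DifferentiableOn ℂ A (sectorDomain ρ θ)) (hε : ε ≠ 0) (T : Matrix (Fin 2) (Fin 2) ℂ) :
    IsTransitionMatrix A (sectorDomain ρ θ) ε lam T ↔
      Scatters (fun x => A x / ε) (lam / ε) (sectorDomain ρ θ) 0 1 (T 1 0) (T 0 0) ∧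
      Scatters (fun x => A x / ε) (lam / ε) (sectorDomain ρ θ) 1 0 (T 1 1) (T 0 1) := by
  have hB : DifferentiableOn ℂ (fun x => A x / ε) (sectorDomain ρ θ) := hA.div_const _
  have hmem : ∀ t : ℝ, (t : ℂ) ∈ sectorDomain ρ θ := ofReal_mem_sectorDomain hR.rho_pos
  constructor
  · rintro ⟨frp, frm, flp, flm, hrp, hrm, hlp, hlm, hT⟩
    rw [isJostPlus_right_iff hR hε] at hrp
    rw [isJostMinus_right_iff hR hε] at hrm
    rw [isJostPlus_left_iff hL hε] at hlp
    rw [isJostMinus_left_iff hL hε] at hlm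
    refine ⟨⟨_, _, hlp.1, hlp.2, ?_⟩, ⟨_, _, hlm.1, hlm.2, ?_⟩⟩
    · have := hrp.2.linear_combination hrm.2 (T 0 0) (T 1 0)
      simp only [mul_zero, mul_one, zero_add, add_zero] at this
      refine ⟨this.1.congr fun t => ?_, this.2.congr fun t => ?_⟩ <;>
        simp [rotate, (hT t (hmem t)).1]
    · have := hrp.2.linear_combination hrm.2 (T 0 1) (T 1 1)
      simp only [mul_zero, mul_one, zero_add, add_zero] at this
      refine ⟨this.1.congr fun t => ?_, this.2.congr fun t => ?_⟩ <;>
        simp [rotate, (hT t (hmem t)).2]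
  · rintro ⟨⟨fp, gp, hp, hpl, hpr⟩, ⟨fm, gm, hm, hml, hmr⟩⟩
    have hbasis := hR.exists_pair hB (lam / ε)
    obtain ⟨f₁, g₁, h₁, hl₁⟩ := hbasis 0 1
    obtain ⟨f₂, g₂, h₂, hl₂⟩ := hbasis 1 0
    refine ⟨fun x => ![f₁ x, g₁ x], fun x => ![f₂ x, g₂ x], fun x => ![fp x, gp x],
      fun x => ![fm x, gm x], (isJostPlus_right_iff hR hε).2 ⟨h₁, hl₁⟩,
      (isJostMinus_right_iff hR hε).2 ⟨h₂, hl₂⟩, (isJostPlus_left_iff hL hε).2 ⟨hp, hpl⟩,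
      (isJostMinus_left_iff hL hε).2 ⟨hm, hml⟩, fun x hx => ⟨?_, ?_⟩⟩
    · have hl := hl₁.linear_combination hl₂ (T 0 0) (T 1 0)
      simp only [mul_zero, mul_one, zero_add, add_zero] at hl
      have := eq_of_hasRealLimit hR.rho_pos hbasis hp (h₁.linear_combination h₂ _ _) hpr hl hx
      ext i
      fin_cases i
      · simpa using this.1
      · simpa using this.2
    · have hl := hl₁.linear_combination hl₂ (T 0 1) (T 1 1)
      simp only [mul_zero, mul_one, zero_add, add_zero] at hl
      have := eq_of_hasRealLimit hR.rho_pos hbasis hm (h₁.linear_combination h₂ _ _) hmr hl hx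
      ext i
      fin_cases i
      · simpa using this.1
      · simpa using this.2

theorem Scatters.unique {B : ℂ → ℂ} {k : ℝ} (hL : RightDecay (fun x => -B (-x)) ρ θ C τ R)
    (hB : DifferentiableOn ℂ B (sectorDomain ρ θ)) {c d c₁ d₁ c₂ d₂ : ℂ}
    (h₁ : Scatters B k (sectorDomain ρ θ) c d c₁ d₁)
    (h₂ : Scatters B k (sectorDomain ρ θ) c d c₂ d₂) : c₁ = c₂ ∧ d₁ = d₂ := by
  obtain ⟨f₁, g₁, hp₁, hl₁, hr₁⟩ := h₁
  obtain ⟨f₂, g₂, hp₂, hl₂, hr₂⟩ := h₂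
  have heq := fun t : ℝ => eq_of_hasRealLimit hL.rho_pos (hL.exists_pair_left hB k) hp₁ hp₂ hl₁ hl₂
    (ofReal_mem_sectorDomain hL.rho_pos t)
  exact ⟨tendsto_nhds_unique hr₁.1 (hr₂.1.congr fun t => by simp [rotate, (heq t).1]),
    tendsto_nhds_unique hr₁.2 (hr₂.2.congr fun t => by simp [rotate, (heq t).2])⟩

theorem existsUnique_isTransitionMatrix (hR : RightDecay (fun x => A x / ε) ρ θ C τ R)
    (hL : RightDecay (fun x => -(A (-x) / ε)) ρ θ C' τ' R')
    (hA : DifferentiableOn ℂ A (sectorDomain ρ θ)) (hε : ε ≠ 0) (lam : ℝ) :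
    ∃! T : Matrix (Fin 2) (Fin 2) ℂ, IsTransitionMatrix A (sectorDomain ρ θ) ε lam T := by
  have hB : DifferentiableOn ℂ (fun x => A x / ε) (sectorDomain ρ θ) := hA.div_const _
  have hex : ∀ c d, ∃ c' d', Scatters (fun x => A x / ε) (lam / ε) (sectorDomain ρ θ) c d c' d' := by
    intro c d
    obtain ⟨f, g, h, hl⟩ := RightDecay.exists_pair_left hL hB (lam / ε) c d
    obtain ⟨c', d', hr⟩ := hR.hasRealLimit h
    exact ⟨c', d', f, g, h, hl, hr⟩
  obtain ⟨b, a, h1⟩ := hex 0 1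
  obtain ⟨b', a', h2⟩ := hex 1 0
  refine ⟨!![a, a'; b, b'], (isTransitionMatrix_iff hR hL hA hε _).2 ⟨by simpa, by simpa⟩,
    fun T hT => ?_⟩
  obtain ⟨k1, k2⟩ := (isTransitionMatrix_iff hR hL hA hε _).1 hT
  have e1 := k1.unique hL hB h1
  have e2 := k2.unique hL hB h2
  ext i j
  fin_cases i <;> fin_cases j <;> simp [e1, e2]

theorem scatters_coeff (hR : RightDecay (fun x => A x / ε) ρ θ C τ R)
    (hL : RightDecay (fun x => -(A (-x) / ε)) ρ θ C' τ' R')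
    (hA : DifferentiableOn ℂ A (sectorDomain ρ θ)) (hε : ε ≠ 0) (lam : ℝ) :
    Scatters (fun x => A x / ε) (lam / ε) (sectorDomain ρ θ) 0 1
      (coeffB A (sectorDomain ρ θ) ε lam) (coeffA A (sectorDomain ρ θ) ε lam) :=
  ((isTransitionMatrix_iff hR hL hA hε _).1 (Classical.epsilon_spec
    (existsUnique_isTransitionMatrix hR hL hA hε lam).exists)).1

/-- Conservation of `|f|² + |g|²` along the real axis when `B` is real there. -/
theorem Scatters.norm_sq_eq {B : ℂ → ℂ} {k : ℝ} {U : Set ℂ} {c d c' d' : ℂ}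
    (hU : ∀ t : ℝ, (t : ℂ) ∈ U) (hB : ∀ t : ℝ, (B t).im = 0) (h : Scatters B k U c d c' d') :
    ‖c'‖ ^ 2 + ‖d'‖ ^ 2 = ‖c‖ ^ 2 + ‖d‖ ^ 2 := by
  obtain ⟨f, g, hp, hl, hr⟩ := h
  have hE : ∀ t : ℝ, HasDerivAt (fun t : ℝ => ‖f t‖ ^ 2 + ‖g t‖ ^ 2) 0 t := by
    intro t
    have h1 := (hp t (hU t)).1.comp_ofReal
    have h2 := (hp t (hU t)).2.comp_ofReal
    refine ((hasDerivAt_norm_sq h1).add (hasDerivAt_norm_sq h2)).congr_deriv ?_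
    simp [hB t]
    ring
  have hconst : ∀ t : ℝ, ‖f t‖ ^ 2 + ‖g t‖ ^ 2 = ‖f 0‖ ^ 2 + ‖g 0‖ ^ 2 := fun t => by
    simpa using is_const_of_deriv_eq_zero (fun t => (hE t).differentiableAt)
      (fun t => (hE t).deriv) t 0
  have hrot : ∀ (q : ℝ) (φ : ℂ → ℂ) (t : ℝ), ‖rotate q φ t‖ = ‖φ t‖ := fun q φ t => by
    rw [rotate, norm_mul, norm_cexp_I_mul]; simp
  have hlim : ∀ (l : Filter ℝ) [l.NeBot] (a b : ℂ), HasRealLimit k l f g a b →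
      ‖a‖ ^ 2 + ‖b‖ ^ 2 = ‖f 0‖ ^ 2 + ‖g 0‖ ^ 2 := by
    intro l _ a b hab
    refine tendsto_nhds_unique ((hab.1.norm.pow 2).add (hab.2.norm.pow 2)) ?_
    simp only [hrot, hconst]
    exact tendsto_const_nhds
  rw [hlim atTop _ _ hr, hlim atBot _ _ hl]

end Transition

/-! ### Integrable weights and Cauchy estimates on strips. -/

/-- The weight `(1 + |t|)^{-1-τ}`. -/
noncomputable def decayWeight (τ t : ℝ) : ℝ := (1 + |t|) ^ (-1 - τ)

/-- The open horizontal strip of half-width `ρ`. -/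
def horizontalStrip (ρ : ℝ) : Set ℂ := {x : ℂ | |x.im| < ρ}

section Weight

variable {τ : ℝ}

theorem decayWeight_pos (τ t : ℝ) : 0 < decayWeight τ t := by
  unfold decayWeight; positivity

theorem decayWeight_le_one (hτ : 0 < τ) (t : ℝ) : decayWeight τ t ≤ 1 :=
  Real.rpow_le_one_of_one_le_of_nonpos (by linarith [abs_nonneg t]) (by linarith)

theorem continuous_decayWeight (τ : ℝ) : Continuous (decayWeight τ) :=
  Continuous.rpow_const (by fun_prop) fun t => Or.inl (by positivity)

theorem integrable_decayWeight (hτ : 0 < τ) : MeasureTheory.Integrable (decayWeight τ) := by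
  have := integrable_one_add_norm (E := ℝ) (μ := MeasureTheory.volume) (r := 1 + τ)
    (by simpa using hτ)
  simp only [neg_add', Real.norm_eq_abs] at this
  exact this

theorem decayWeight_le_of_le {a s t : ℝ} (hτ : 0 < τ) (ha : 0 < a) (h : 1 + |t| ≤ a * (1 + |s|)) :
    decayWeight τ s ≤ a ^ (1 + τ) * decayWeight τ t := by
  have hs : 0 < 1 + |s| := by positivity
  have ht : 0 < 1 + |t| := by positivity
  unfold decayWeight
  rw [show -1 - τ = -(1 + τ) by ring, Real.rpow_neg hs.le, Real.rpow_neg ht.le,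
    ← div_eq_mul_inv, le_div_iff₀ (by positivity), ← div_eq_inv_mul, div_le_iff₀ (by positivity),
    ← Real.mul_rpow ha.le hs.le]
  exact Real.rpow_le_rpow ht.le h (by linarith)

theorem decayWeight_le_of_abs_sub_le {s t : ℝ} (hτ : 0 < τ) (h : |s - t| ≤ 1) :
    decayWeight τ s ≤ 2 ^ (1 + τ) * decayWeight τ t := by
  refine decayWeight_le_of_le hτ two_pos ?_
  have := abs_sub_abs_le_abs_sub t s
  rw [abs_sub_comm] at this
  linarith [abs_nonneg s]

theorem tendsto_decayWeight_cobounded (hτ : 0 < τ) {l : Filter ℝ}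
    (hl : Tendsto (fun t : ℝ => |t|) l atTop) : Tendsto (decayWeight τ) l (𝓝 0) := by
  have h1 : Tendsto (fun t : ℝ => t ^ (-(1 + τ))) atTop (𝓝 0) :=
    tendsto_rpow_neg_atTop (by linarith)
  rw [neg_add'] at h1
  exact h1.comp (tendsto_atTop_add_const_left _ 1 hl)

theorem intervalIntegral_decayWeight_le (hτ : 0 < τ) {a b : ℝ} (hab : a ≤ b) :
    ∫ t in a..b, decayWeight τ t ≤ ∫ t, decayWeight τ t := by
  rw [intervalIntegral.integral_of_le hab]
  exact MeasureTheory.setIntegral_le_integral (integrable_decayWeight hτ)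
    (Eventually.of_forall fun t => (decayWeight_pos τ t).le)

theorem isOpen_horizontalStrip (ρ : ℝ) : IsOpen (horizontalStrip ρ) :=
  isOpen_lt (by fun_prop) (by fun_prop)

theorem horizontalStrip_mono {ρ ρ' : ℝ} (h : ρ' ≤ ρ) : horizontalStrip ρ' ⊆ horizontalStrip ρ :=
  fun _ hx => lt_of_lt_of_le hx h

theorem horizontalStrip_subset_sectorDomain {ρ ρ' θ : ℝ} (h : ρ' ≤ ρ) :
    horizontalStrip ρ' ⊆ sectorDomain ρ θ :=
  fun _ hx => lt_of_lt_of_le hx (h.trans (le_max_left _ _))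

theorem ofReal_mem_horizontalStrip {ρ : ℝ} (hρ : 0 < ρ) (t : ℝ) : (t : ℂ) ∈ horizontalStrip ρ := by
  simpa [horizontalStrip] using hρ

/-- Cauchy's estimate for functions of weighted growth on a strip. -/
theorem exists_norm_deriv_le_decayWeight (hτ : 0 < τ) {ρ ρ' : ℝ} (hρ : ρ' < ρ) :
    ∃ K : ℝ, 0 ≤ K ∧ ∀ (F : ℂ → ℂ) (C : ℝ), DifferentiableOn ℂ F (horizontalStrip ρ) →
      (∀ x ∈ horizontalStrip ρ, ‖F x‖ ≤ C * decayWeight τ x.re) →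
      ∀ x ∈ horizontalStrip ρ', ‖deriv F x‖ ≤ K * C * decayWeight τ x.re := by
  -- The bound `1` lets the weight vary by at most `2 ^ (1 + τ)` over the disc; the other bound
  -- keeps the closed disc in the larger strip.
  set r := min 1 ((ρ - ρ') / 2)
  have hr : 0 < r := lt_min one_pos (by linarith)
  have hr1 : r ≤ 1 := min_le_left _ _
  have hr2 : r ≤ (ρ - ρ') / 2 := min_le_right _ _
  refine ⟨2 ^ (1 + τ) / r, by positivity, fun F C hF hb x hx => ?_⟩
  have hball : Metric.closedBall x r ⊆ horizontalStrip ρ := by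
    intro z hz
    have h1 : ‖z - x‖ ≤ r := by rwa [← mem_closedBall_iff_norm]
    have h2 := (Complex.abs_im_le_norm (z - x)).trans h1
    rw [Complex.sub_im] at h2
    have h3 := abs_sub_abs_le_abs_sub z.im x.im
    have hx' : |x.im| < ρ' := hx
    show |z.im| < ρ
    linarith
  have hC : 0 ≤ C := by
    have := (norm_nonneg _).trans (hb x (hball (Metric.mem_closedBall_self hr.le)))
    exact nonneg_of_mul_nonneg_left this (decayWeight_pos _ _)
  have := Complex.norm_deriv_le_of_forall_mem_sphere_norm_le (c := x) (R := r)
    (C := C * (2 ^ (1 + τ) * decayWeight τ x.re)) (f := F) hr ?_ ?_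
  · refine this.trans_eq ?_
    ring
  · exact (hF.mono (by
      rw [closure_ball x hr.ne']; exact hball)).diffContOnCl
  · intro z hz
    refine (hb z (hball (Metric.sphere_subset_closedBall hz))).trans ?_
    have h1 : ‖z - x‖ = r := by rwa [← mem_sphere_iff_norm]
    have h2 := (Complex.abs_re_le_norm (z - x)).trans (h1.le.trans hr1)
    rw [Complex.sub_re] at h2
    exact mul_le_mul_of_nonneg_left (decayWeight_le_of_abs_sub_le hτ h2) hC

end Weight

/-! ### Bounds for the potential. -/

section Potential

variable {A : ℝ → ℝ} {Aext : ℂ → ℂ} {ρ₀ θ₀ : ℝ}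

theorem AssumptionA1.tan_pos (hA : AssumptionA1 A Aext ρ₀ θ₀) : 0 < Real.tan θ₀ :=
  Real.tan_pos_of_pos_of_lt_pi_div_two hA.theta_pos hA.theta_lt

theorem AssumptionA1.exists_decay (hA : AssumptionA1 A Aext ρ₀ θ₀) :
    ∃ τ C R : ℝ, 0 < τ ∧ 0 ≤ C ∧ 1 ≤ R ∧
      ∀ x ∈ sectorDomain ρ₀ θ₀, R ≤ ‖x‖ → ‖Aext x‖ ≤ C * ‖x‖ ^ (-1 - τ) := by
  obtain ⟨τ, hτ, hO⟩ := hA.decay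
  obtain ⟨C, hC, hb⟩ := hO.exists_nonneg
  rw [Asymptotics.isBigOWith_iff, eventually_inf_principal,
    (Metric.hasBasis_cobounded_compl_closedBall (0 : ℂ)).eventually_iff] at hb
  obtain ⟨r, -, hr⟩ := hb
  refine ⟨τ, C, max 1 (r + 1), hτ, hC, le_max_left _ _, fun x hx hR => ?_⟩
  have h1 : r + 1 ≤ ‖x‖ := (le_max_right _ _).trans hR
  have := hr (x := x) (by simp; linarith) hx
  rwa [Real.norm_of_nonneg (by positivity)] at this

theorem AssumptionA1.exists_rightDecay (hA : AssumptionA1 A Aext ρ₀ θ₀) {ε : ℝ} (hε : 0 < ε) :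
    ∃ C τ R : ℝ, RightDecay (fun x => Aext x / ε) ρ₀ θ₀ C τ R ∧
      RightDecay (fun x => -(Aext (-x) / ε)) ρ₀ θ₀ C τ R := by
  obtain ⟨τ, C, R, hτ, hC, hR, hb⟩ := hA.exists_decay
  have key : ∀ x ∈ sectorDomain ρ₀ θ₀, R ≤ |x.re| → ‖Aext x / ε‖ ≤ C / ε * |x.re| ^ (-1 - τ) := by
    intro x hx hxR
    have h1 := Complex.abs_re_le_norm x
    have h2 := hb x hx (hxR.trans h1)
    rw [norm_div, Complex.norm_real, Real.norm_of_nonneg hε.le, div_mul_eq_mul_div]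
    gcongr
    exact h2.trans (mul_le_mul_of_nonneg_left
      (Real.rpow_le_rpow_of_nonpos (by linarith) h1 (by linarith)) hC)
  refine ⟨C / ε, τ, R, ⟨hA.rho_pos, hA.tan_pos, by positivity, hτ, by linarith, ?_⟩,
    ⟨hA.rho_pos, hA.tan_pos, by positivity, hτ, by linarith, ?_⟩⟩
  · intro x hx hxR
    have := key x hx (hxR.trans (le_abs_self _))
    rwa [abs_of_nonneg (by linarith)] at this
  · intro x hx hxR
    have := key (-x) (neg_mem_sectorDomain hx) (by
      rw [Complex.neg_re, abs_neg]; exact hxR.trans (le_abs_self _))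
    rw [norm_neg]
    rwa [Complex.neg_re, abs_neg, abs_of_nonneg (by linarith)] at this

/-- Far out this is the assumed decay. The remaining part of the strip lies in a compact subset of
the domain, thanks to the halved width, and there the weight is bounded below. -/
theorem AssumptionA1.exists_strip_bound (hA : AssumptionA1 A Aext ρ₀ θ₀) :
    ∃ τ C : ℝ, 0 < τ ∧ 0 ≤ C ∧
      ∀ x ∈ horizontalStrip (ρ₀ / 2), ‖Aext x‖ ≤ C * decayWeight τ x.re := by
  obtain ⟨τ, C, R, hτ, hC, hR, hb⟩ := hA.exists_decay
  have hρ := hA.rho_pos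
  set S : Set ℂ := Metric.closedBall 0 R ∩ {x : ℂ | |x.im| ≤ ρ₀ / 2}
  have hS : IsCompact S := (isCompact_closedBall _ _).inter_right
    (isClosed_le (by fun_prop) (by fun_prop))
  have hSD : S ⊆ sectorDomain ρ₀ θ₀ := fun x hx => by
    refine horizontalStrip_subset_sectorDomain le_rfl ?_
    have : |x.im| ≤ ρ₀ / 2 := hx.2
    show |x.im| < ρ₀
    linarith
  obtain ⟨M, hM⟩ := hS.exists_bound_of_continuousOn
    (hA.analytic.continuousOn.mono hSD)
  refine ⟨τ, max (C * 2 ^ (1 + τ)) (|M| * (1 + R) ^ (1 + τ)), hτ,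
    le_max_of_le_left (by positivity), fun x hx => ?_⟩
  have hw := decayWeight_pos τ x.re
  have hre := Complex.abs_re_le_norm x
  rcases le_total R ‖x‖ with h | h
  · refine (hb x (horizontalStrip_subset_sectorDomain (by linarith) hx) h).trans
      (le_trans ?_ (mul_le_mul_of_nonneg_right (le_max_left _ _) hw.le))
    rw [mul_assoc]
    refine mul_le_mul_of_nonneg_left ?_ hC
    unfold decayWeight
    have h0 : 0 < 1 + |x.re| := by positivity
    have h1 : (1 + |x.re|) / 2 ≤ ‖x‖ := by linarith
    refine (Real.rpow_le_rpow_of_nonpos (by positivity) h1 (by linarith)).trans_eq ?_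
    rw [Real.div_rpow h0.le zero_le_two, div_eq_mul_inv, ← Real.rpow_neg zero_le_two,
      show -(-1 - τ) = 1 + τ by ring, mul_comm]
  · have hxS : x ∈ S := ⟨by simpa using h, (show |x.im| < ρ₀ / 2 from hx).le⟩
    refine ((hM x hxS).trans (le_abs_self M)).trans
      (le_trans ?_ (mul_le_mul_of_nonneg_right (le_max_right _ _) hw.le))
    rw [mul_assoc]
    refine le_mul_of_one_le_right (abs_nonneg M) ?_
    have := decayWeight_le_of_le (τ := τ) (s := 0) (t := x.re) (a := 1 + R) hτ (by linarith)
      (by simp; linarith)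
    simpa [decayWeight] using this

end Potential

/-! ### The phase speed and the amplitude, uniformly in the spectral parameter. -/

/-- Bounds for the phase derivative `q = √(1 + p²)` and the amplitude `α = p / (1 + q)` on a
horizontal strip. -/
structure PhaseBounds (p q α : ℂ → ℂ) (τ ρ K : ℝ) : Prop where
  tau_pos : 0 < τ
  rho_pos : 0 < ρ
  K_nonneg : 0 ≤ K
  q_sq : ∀ x ∈ horizontalStrip ρ, q x ^ 2 = 1 + p x ^ 2
  alpha_mul : ∀ x ∈ horizontalStrip ρ, α x * (1 + q x) = p x
  one_add_ne : ∀ x ∈ horizontalStrip ρ, 1 + q x ≠ 0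
  diff_q : DifferentiableOn ℂ q (horizontalStrip ρ)
  diff_α : DifferentiableOn ℂ α (horizontalStrip ρ)
  q_im : ∀ t : ℝ, (q t).im = 0
  q_re : ∀ t : ℝ, 1 ≤ (q t).re
  half_le : ∀ x ∈ horizontalStrip ρ, 1 / 2 ≤ ‖1 + α x ^ 2‖
  q_sub_one : ∀ x ∈ horizontalStrip ρ, ‖q x - 1‖ ≤ K * decayWeight τ x.re
  α_le : ∀ x ∈ horizontalStrip ρ, ‖α x‖ ≤ K * decayWeight τ x.re
  deriv_q : ∀ x ∈ horizontalStrip ρ, ‖deriv q x‖ ≤ K * decayWeight τ x.re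
  deriv_deriv_q : ∀ x ∈ horizontalStrip ρ, ‖deriv (deriv q) x‖ ≤ K * decayWeight τ x.re
  deriv_α : ∀ x ∈ horizontalStrip ρ, ‖deriv α x‖ ≤ K * decayWeight τ x.re

/-- The branch of `√(1 + p²)` with non-negative real part. -/
noncomputable def phaseSpeed (p : ℂ → ℂ) (x : ℂ) : ℂ := Complex.sqrt (1 + p x ^ 2)

theorem Complex.sqrt_sq_eq (z : ℂ) : Complex.sqrt z ^ 2 = z := by
  simp [Complex.sqrt, ← Complex.cpow_nat_mul]

theorem Complex.sqrt_re_nonneg (z : ℂ) : 0 ≤ (Complex.sqrt z).re := by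
  rw [Complex.sqrt, Complex.cpow_inv_two_re]
  exact Real.sqrt_nonneg _

theorem one_le_norm_one_add_of_re_nonneg {z : ℂ} (hz : 0 ≤ z.re) : 1 ≤ ‖1 + z‖ := by
  have := Complex.re_le_norm (1 + z)
  rw [Complex.add_re, Complex.one_re] at this
  linarith

theorem phaseSpeed_ofReal {p : ℂ → ℂ} {t : ℝ} (h : (p t).im = 0) :
    (phaseSpeed p t).im = 0 ∧ 1 ≤ (phaseSpeed p t).re := by
  obtain ⟨r, hr⟩ : ∃ r : ℝ, p t = r := ⟨(p t).re, Complex.ext (by simp) (by simpa using h)⟩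
  have h0 : (0 : ℝ) ≤ 1 + r ^ 2 := by positivity
  have : phaseSpeed p t = (√(1 + r ^ 2) : ℝ) := by
    rw [phaseSpeed, hr, Complex.sqrt, show (1 : ℂ) + r ^ 2 = ((1 + r ^ 2 : ℝ) : ℂ) by push_cast; rfl,
      Real.sqrt_eq_rpow, Complex.ofReal_cpow h0]
    norm_num
  rw [this]
  refine ⟨Complex.ofReal_im _, ?_⟩
  rw [Complex.ofReal_re, Real.one_le_sqrt]
  linarith [sq_nonneg r]

/-- A small imaginary part of `z` gives `Re (1 + z²) ≥ 3/4`, away from the branch cut, and `Re q ≥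
0` gives `|1 + q| ≥ 1`. The bounds follow from `(q - 1)(1 + q) = z²` and, with `a = z / (1 + q)`,
from `1 + a² = 2q / (1 + q)`. -/
theorem phaseBounds_aux {z : ℂ} (hz : |z.im| ≤ 1 / 2) {q : ℂ} (hq : q ^ 2 = 1 + z ^ 2)
    (hre : 0 ≤ q.re) : 0 < (1 + z ^ 2).re ∧ ‖q - 1‖ ≤ ‖z‖ ^ 2 ∧ ‖z / (1 + q)‖ ≤ ‖z‖ ∧
      1 / 2 ≤ ‖1 + (z / (1 + q)) ^ 2‖ := by
  have h1 := one_le_norm_one_add_of_re_nonneg hre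
  have hne : 1 + q ≠ 0 := norm_pos_iff.1 (one_pos.trans_le h1)
  have him : z.im ^ 2 ≤ 1 / 4 := by
    rw [← sq_abs]; nlinarith [abs_nonneg z.im]
  have hR : 3 / 4 ≤ (1 + z ^ 2).re := by
    rw [Complex.add_re, Complex.one_re, pow_two, Complex.mul_re]
    nlinarith [sq_nonneg z.re]
  have hn : 3 / 4 ≤ ‖q‖ ^ 2 := by
    rw [← norm_pow, hq]; exact hR.trans (Complex.re_le_norm _)
  have hq1 : 1 / 2 ≤ ‖q‖ := by nlinarith [norm_nonneg q]
  refine ⟨by linarith, ?_, ?_, ?_⟩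
  · have : (q - 1) * (1 + q) = z ^ 2 := by linear_combination hq
    rw [← norm_pow, ← this, norm_mul]
    exact le_mul_of_one_le_right (norm_nonneg _) h1
  · rw [norm_div]
    exact div_le_self (norm_nonneg _) h1
  · have : 1 + (z / (1 + q)) ^ 2 = 2 * q / (1 + q) := by
      field_simp
      linear_combination -hq
    rw [this, norm_div, norm_mul, Complex.norm_ofNat, div_le_div_iff₀ two_pos (by linarith)]
    have := norm_add_le 1 q
    rw [norm_one] at this
    linarith

theorem AssumptionA1.exists_phaseBounds {A : ℝ → ℝ} {Aext : ℂ → ℂ} {ρ₀ θ₀ : ℝ}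
    (hA : AssumptionA1 A Aext ρ₀ θ₀) {δ : ℝ} (hδ : 0 < δ) :
    ∃ τ ρ K : ℝ, ρ ≤ ρ₀ ∧ ∀ lam : ℝ, δ ≤ |lam| →
      PhaseBounds (fun x => Aext x / lam) (phaseSpeed fun x => Aext x / lam)
        (fun x => Aext x / lam / (1 + phaseSpeed (fun x => Aext x / lam) x)) τ ρ K := by
  obtain ⟨τ, C, hτ, hC, hb⟩ := hA.exists_strip_bound
  have hρ := hA.rho_pos
  have hdA : DifferentiableOn ℂ Aext (horizontalStrip (ρ₀ / 2)) :=
    hA.analytic.differentiableOn.mono (horizontalStrip_subset_sectorDomain (by linarith))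
  obtain ⟨K₁, hK₁, hC₁⟩ := exists_norm_deriv_le_decayWeight hτ (show ρ₀ / 4 < ρ₀ / 2 by linarith)
  have hdb := hC₁ Aext C hdA hb
  -- `K₁ * C` bounds the derivative of `Aext`, which is real on the real axis. In this strip its
  -- imaginary part is thus at most `δ / 2`, and that of `Aext / lam` at most `1 / 2` for every
  -- `|lam| ≥ δ`.
  set r := min (ρ₀ / 4) (δ / (2 * (K₁ * C + 1)))
  have hKC : 0 ≤ K₁ * C := mul_nonneg hK₁ hC
  have hr : 0 < r := lt_min (by linarith) (by positivity)
  have hr4 : r ≤ ρ₀ / 4 := min_le_left _ _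
  have hrδ : r * (K₁ * C) ≤ δ / 2 := by
    have h1 : r ≤ δ / (2 * (K₁ * C + 1)) := min_le_right _ _
    rw [le_div_iff₀ (by positivity)] at h1
    nlinarith
  have him : ∀ x ∈ horizontalStrip r, |(Aext x).im| ≤ δ / 2 := by
    intro x hx
    have hconv : Convex ℝ (horizontalStrip r) := by
      have : horizontalStrip r = Complex.imLm ⁻¹' Set.Ioo (-r) r := by
        ext z; simp [horizontalStrip, abs_lt]
      rw [this]
      exact (convex_Ioo _ _).linear_preimage _
    have h1 := hconv.norm_image_sub_le_of_norm_deriv_le (f := Aext) (C := K₁ * C)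
      (x := (x.re : ℂ)) (y := x) (fun z hz => hdA.differentiableAt
        ((isOpen_horizontalStrip _).mem_nhds (horizontalStrip_mono (by linarith) hz)))
      (fun z hz => (hdb z (horizontalStrip_mono hr4 hz)).trans
        (mul_le_of_le_one_right hKC (decayWeight_le_one hτ _)))
      (ofReal_mem_horizontalStrip hr _) hx
    have h2 : x - (x.re : ℂ) = x.im * Complex.I := by
      apply Complex.ext <;> simp
    rw [h2, norm_mul, Complex.norm_I, mul_one, Complex.norm_real, Real.norm_eq_abs] at h1
    have h3 := (Complex.abs_im_le_norm _).trans h1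
    rw [Complex.sub_im, hA.extends_real, Complex.ofReal_im, sub_zero] at h3
    have h4 : |x.im| ≤ r := le_of_lt hx
    have h5 := mul_le_mul_of_nonneg_left h4 hKC
    linarith
  obtain ⟨K₂, hK₂, hC₂⟩ := exists_norm_deriv_le_decayWeight hτ (show r / 2 < r by linarith)
  obtain ⟨K₃, hK₃, hC₃⟩ := exists_norm_deriv_le_decayWeight hτ (show r / 4 < r / 2 by linarith)
  set N := C / δ + (C / δ) ^ 2
  have hN : 0 ≤ N := by positivity
  -- Two Cauchy estimates, for `q'` and `q''`, each halve the strip. The summands of the constant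
  -- bound the functions, their first derivatives and `q''`; none depends on `lam`.
  refine ⟨τ, r / 4, N + K₂ * N + K₃ * (K₂ * N), by linarith, fun lam hlam => ?_⟩
  set p : ℂ → ℂ := fun x => Aext x / lam with hp
  set q := phaseSpeed p with hq
  have hlam0 : 0 < |lam| := hδ.trans_le hlam
  have hsub : ∀ {s}, s ≤ r → horizontalStrip s ⊆ horizontalStrip (ρ₀ / 2) := fun hs =>
    horizontalStrip_mono (by linarith)
  have hpim : ∀ x ∈ horizontalStrip r, |(p x).im| ≤ 1 / 2 := by
    intro x hx
    simp only [hp, Complex.div_ofReal_im]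
    rw [abs_div, div_le_iff₀ hlam0]
    linarith [him x hx]
  have hpn : ∀ x ∈ horizontalStrip r, ‖p x‖ ≤ C / δ * decayWeight τ x.re := by
    intro x hx
    simp only [hp]
    rw [norm_div, Complex.norm_real, Real.norm_eq_abs, div_mul_eq_mul_div]
    exact div_le_div₀ (mul_nonneg hC (decayWeight_pos _ _).le) (hb x (hsub le_rfl hx)) hδ hlam
  have hqsq : ∀ x, q x ^ 2 = 1 + p x ^ 2 := fun x => Complex.sqrt_sq_eq _
  have hqre : ∀ x, 0 ≤ (q x).re := fun x => Complex.sqrt_re_nonneg _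
  have haux := fun x (hx : x ∈ horizontalStrip r) => phaseBounds_aux (hpim x hx) (hqsq x) (hqre x)
  have hne : ∀ x, 1 + q x ≠ 0 := fun x =>
    norm_pos_iff.1 (one_pos.trans_le (one_le_norm_one_add_of_re_nonneg (hqre x)))
  have hdp : DifferentiableOn ℂ p (horizontalStrip r) :=
    (hdA.mono (hsub le_rfl)).div_const _
  have hdq : DifferentiableOn ℂ q (horizontalStrip r) := fun x hx =>
    (Complex.differentiableAt_sqrt (Or.inl (haux x hx).1)).comp_differentiableWithinAt x
      (((hdp x hx).pow 2).const_add 1)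
  have hdα : DifferentiableOn ℂ (fun x => p x / (1 + q x)) (horizontalStrip r) :=
    hdp.div (hdq.const_add 1) fun x _ => hne x
  have hw1 := decayWeight_le_one hτ
  have hw0 := decayWeight_pos τ
  have bq : ∀ x ∈ horizontalStrip r, ‖q x - 1‖ ≤ N * decayWeight τ x.re := by
    intro x hx
    refine (haux x hx).2.1.trans ((pow_le_pow_left₀ (norm_nonneg _) (hpn x hx) 2).trans ?_)
    have h1 : decayWeight τ x.re ^ 2 ≤ decayWeight τ x.re := by
      nlinarith [hw1 x.re, hw0 x.re]
    rw [mul_pow]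
    refine (mul_le_mul_of_nonneg_left h1 (by positivity)).trans
      (mul_le_mul_of_nonneg_right ?_ (hw0 _).le)
    simp only [N]
    linarith [div_nonneg hC hδ.le]
  have bα : ∀ x ∈ horizontalStrip r, ‖p x / (1 + q x)‖ ≤ N * decayWeight τ x.re := by
    intro x hx
    refine (haux x hx).2.2.1.trans ((hpn x hx).trans (mul_le_mul_of_nonneg_right ?_ (hw0 _).le))
    simp only [N]
    linarith [sq_nonneg (C / δ)]
  have bdq : ∀ x ∈ horizontalStrip (r / 2), ‖deriv q x‖ ≤ K₂ * N * decayWeight τ x.re := by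
    intro x hx
    have := hC₂ (fun x => q x - 1) N (hdq.sub_const 1) bq x hx
    simpa using this
  have bdα := hC₂ _ N hdα bα
  have bddq := hC₃ _ (K₂ * N) ((hdq.deriv (isOpen_horizontalStrip _)).mono
    (horizontalStrip_mono (by linarith))) bdq
  have s1 : horizontalStrip (r / 4) ⊆ horizontalStrip r := horizontalStrip_mono (by linarith)
  have s2 : horizontalStrip (r / 4) ⊆ horizontalStrip (r / 2) := horizontalStrip_mono (by linarith)
  have k1 : 0 ≤ K₂ * N := by positivity
  have k2 : 0 ≤ K₃ * (K₂ * N) := by positivity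
  have up : ∀ {a b : ℝ} {x : ℂ}, a ≤ b * decayWeight τ x.re → b ≤ N + K₂ * N + K₃ * (K₂ * N) →
      a ≤ (N + K₂ * N + K₃ * (K₂ * N)) * decayWeight τ x.re := fun h1 h2 =>
    h1.trans (mul_le_mul_of_nonneg_right h2 (hw0 _).le)
  have hreal : ∀ t : ℝ, (p t).im = 0 := fun t => by
    simp [hp, hA.extends_real, Complex.div_ofReal_im]
  exact
    { tau_pos := hτ
      rho_pos := by linarith
      K_nonneg := by positivity
      q_sq := fun x _ => hqsq x
      alpha_mul := fun x _ => div_mul_cancel₀ _ (hne x)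
      one_add_ne := fun x _ => hne x
      diff_q := hdq.mono s1
      diff_α := hdα.mono s1
      q_im := fun t => (phaseSpeed_ofReal (hreal t)).1
      q_re := fun t => (phaseSpeed_ofReal (hreal t)).2
      half_le := fun x hx => (haux x (s1 hx)).2.2.2
      q_sub_one := fun x hx => up (bq x (s1 hx)) (by linarith)
      α_le := fun x hx => up (bα x (s1 hx)) (by linarith)
      deriv_q := fun x hx => up (bdq x (s2 hx)) (by linarith)
      deriv_deriv_q := fun x hx => up (bddq x hx) (by linarith)
      deriv_α := fun x hx => up (bdα x (s2 hx)) (by linarith) }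

/-! ### Approximate level curves of the phase. -/

/-- The curve `t + i s / q(t)`, along which the imaginary part of `∫ q` is constant to first order
in `s`. -/
noncomputable def levelCurve (q : ℂ → ℂ) (s t : ℝ) : ℂ := t + (s / (q t).re : ℝ) * Complex.I

/-- The velocity of `levelCurve`. -/
noncomputable def levelVelocity (q : ℂ → ℂ) (s t : ℝ) : ℂ :=
  1 + (-(s * (deriv q t).re) / (q t).re ^ 2 : ℝ) * Complex.I

section LevelCurve

variable {p q α : ℂ → ℂ} {τ ρ K s : ℝ}

theorem levelCurve_re (t : ℝ) : (levelCurve q s t).re = t := by simp [levelCurve]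

theorem levelCurve_im (t : ℝ) : (levelCurve q s t).im = s / (q t).re := by simp [levelCurve]

theorem PhaseBounds.abs_levelCurve_im_le (H : PhaseBounds p q α τ ρ K) (s t : ℝ) :
    |(levelCurve q s t).im| ≤ |s| := by
  rw [levelCurve_im, abs_div]
  exact div_le_self (abs_nonneg s) ((H.q_re t).trans (le_abs_self _))

theorem PhaseBounds.levelCurve_mem (H : PhaseBounds p q α τ ρ K) (hs : |s| < ρ) (t : ℝ) :
    levelCurve q s t ∈ horizontalStrip ρ :=
  lt_of_le_of_lt (H.abs_levelCurve_im_le s t) hs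

theorem PhaseBounds.hasDerivAt_q (H : PhaseBounds p q α τ ρ K) {x : ℂ}
    (hx : x ∈ horizontalStrip ρ) : HasDerivAt q (deriv q x) x :=
  (H.diff_q.differentiableAt ((isOpen_horizontalStrip ρ).mem_nhds hx)).hasDerivAt

theorem PhaseBounds.hasDerivAt_α (H : PhaseBounds p q α τ ρ K) {x : ℂ}
    (hx : x ∈ horizontalStrip ρ) : HasDerivAt α (deriv α x) x :=
  (H.diff_α.differentiableAt ((isOpen_horizontalStrip ρ).mem_nhds hx)).hasDerivAt

theorem PhaseBounds.deriv_q_im (H : PhaseBounds p q α τ ρ K) (t : ℝ) : (deriv q t).im = 0 := by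
  have h1 := (H.hasDerivAt_q (ofReal_mem_horizontalStrip H.rho_pos t)).comp_ofReal
  have h2 := Complex.imCLM.hasFDerivAt.comp_hasDerivAt t h1
  have h3 : (fun t : ℝ => Complex.imCLM (q t)) = fun _ => 0 := by
    funext t; simpa using H.q_im t
  have h4 : HasDerivAt (fun t : ℝ => Complex.imCLM (q t)) (Complex.imCLM (deriv q t)) t := h2
  rw [h3] at h4
  simpa using h4.unique (hasDerivAt_const t 0)

theorem PhaseBounds.hasDerivAt_levelCurve (H : PhaseBounds p q α τ ρ K) (s t : ℝ) :
    HasDerivAt (levelCurve q s) (levelVelocity q s t) t := by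
  have h1 := (H.hasDerivAt_q (ofReal_mem_horizontalStrip H.rho_pos t)).real_of_complex
  have hne : (q t).re ≠ 0 := (one_pos.trans_le (H.q_re t)).ne'
  have h2 := ((hasDerivAt_const t s).div h1 hne).ofReal_comp.mul_const Complex.I
  refine ((Complex.ofRealCLM.hasDerivAt (x := t)).add h2).congr_deriv ?_
  simp [levelVelocity]

theorem PhaseBounds.norm_levelVelocity_le (H : PhaseBounds p q α τ ρ K) (hs : K * |s| ≤ 1) (t : ℝ) :
    ‖levelVelocity q s t‖ ≤ 2 := by
  have hq := H.q_re t
  have h1 : |(deriv q t).re| ≤ K := (Complex.abs_re_le_norm _).trans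
    ((H.deriv_q t (ofReal_mem_horizontalStrip H.rho_pos t)).trans
      (mul_le_of_le_one_right H.K_nonneg (decayWeight_le_one H.tau_pos _)))
  have h2 : |-(s * (deriv q t).re) / (q t).re ^ 2| ≤ 1 := by
    rw [abs_div, abs_neg, abs_mul, abs_of_pos (by positivity : 0 < (q t).re ^ 2)]
    refine div_le_one_of_le₀ ?_ (by positivity)
    have := mul_le_mul_of_nonneg_left h1 (abs_nonneg s)
    nlinarith
  calc ‖levelVelocity q s t‖ ≤ ‖(1 : ℂ)‖ +
        ‖((-(s * (deriv q t).re) / (q t).re ^ 2 : ℝ) : ℂ) * Complex.I‖ := norm_add_le _ _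
    _ ≤ 1 + 1 := by
        rw [norm_one, norm_mul, Complex.norm_I, mul_one, Complex.norm_real, Real.norm_eq_abs]
        linarith
    _ = 2 := by norm_num

/-- The mean value inequality is applied twice on a vertical segment. The real part is fixed there,
so the bound on `q''` keeps the constant weight `decayWeight τ t`. -/
theorem PhaseBounds.taylor (H : PhaseBounds p q α τ ρ K) (hs : |s| < ρ) (t : ℝ) {y : ℝ}
    (hy : |y| ≤ |s|) :
    ‖q (t + y * Complex.I) - (q t + y * Complex.I * deriv q t)‖ ≤
      K * decayWeight τ t * s ^ 2 := by
  set V : Set ℂ := {z | z.re = t ∧ z.im ∈ Set.Icc (-|s|) |s|} with hV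
  have hVeq : V = Complex.reLm ⁻¹' {t} ∩ Complex.imLm ⁻¹' Set.Icc (-|s|) |s| := rfl
  have hconv : Convex ℝ V := by
    rw [hVeq]
    exact ((convex_singleton t).linear_preimage _).inter ((convex_Icc _ _).linear_preimage _)
  have hstrip : ∀ z ∈ V, z ∈ horizontalStrip ρ := fun z hz =>
    (abs_le.2 hz.2).trans_lt hs
  have ht : (t : ℂ) ∈ V := ⟨by simp, by simp⟩
  have hsub : ∀ z ∈ V, ‖z - t‖ ≤ |s| := by
    intro z hz
    have : z - t = z.im * Complex.I := by
      apply Complex.ext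
      · simp [hz.1]
      · simp
    rw [this, norm_mul, Complex.norm_I, mul_one, Complex.norm_real, Real.norm_eq_abs]
    exact abs_le.2 hz.2
  have hdd : DifferentiableOn ℂ (deriv q) (horizontalStrip ρ) :=
    H.diff_q.deriv (isOpen_horizontalStrip ρ)
  have hKw : 0 ≤ K * decayWeight τ t := mul_nonneg H.K_nonneg (decayWeight_pos _ _).le
  have h1 : ∀ z ∈ V, ‖deriv q z - deriv q t‖ ≤ K * decayWeight τ t * |s| := by
    intro z hz
    have := hconv.norm_image_sub_le_of_norm_deriv_le (f := deriv q) (C := K * decayWeight τ t)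
      (fun w hw => hdd.differentiableAt ((isOpen_horizontalStrip ρ).mem_nhds (hstrip w hw)))
      (fun w hw => by
        have := H.deriv_deriv_q w (hstrip w hw)
        rwa [hw.1] at this) ht hz
    exact this.trans (mul_le_mul_of_nonneg_left (hsub z hz) hKw)
  have hyV : (t + y * Complex.I : ℂ) ∈ V := ⟨by simp, by simpa using abs_le.1 hy⟩
  have hφ : ∀ w ∈ V, HasDerivAt (fun z => q z - z * deriv q t) (deriv q w - deriv q t) w :=
    fun w hw => ((H.hasDerivAt_q (hstrip w hw)).sub
      ((hasDerivAt_id' w).mul_const (deriv q t))).congr_deriv (by simp)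
  have := hconv.norm_image_sub_le_of_norm_deriv_le (f := fun z => q z - z * deriv q t)
    (C := K * decayWeight τ t * |s|) (fun w hw => (hφ w hw).differentiableAt)
    (fun w hw => by rw [(hφ w hw).deriv]; exact h1 w hw) ht hyV
  have h2 := this.trans (mul_le_mul_of_nonneg_left (hsub _ hyV) (by positivity))
  rw [mul_assoc, abs_mul_abs_self, ← pow_two] at h2
  refine le_trans (le_of_eq ?_) h2
  congr 1
  ring

/-- Along the level curve the phase velocity is real up to second order in `s`. -/
theorem PhaseBounds.abs_im_phase_le (H : PhaseBounds p q α τ ρ K) (hs : |s| < ρ)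
    (hKs : K * |s| ≤ 1) (t : ℝ) :
    |(q (levelCurve q s t) * levelVelocity q s t).im| ≤ 2 * K * s ^ 2 * decayWeight τ t := by
  have hy : |s / (q t).re| ≤ |s| := by
    simpa [levelCurve_im] using H.abs_levelCurve_im_le s t
  have hT := H.taylor hs t hy
  set r := q (levelCurve q s t) - (q t + (s / (q t).re : ℝ) * Complex.I * deriv q t) with hr
  have hq : q t = ((q t).re : ℂ) := Complex.ext (by simp) (by simp [H.q_im t])
  have hd : deriv q t = ((deriv q t).re : ℂ) := Complex.ext (by simp) (by simp [H.deriv_q_im t])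
  have hne : (q t).re ≠ 0 := (one_pos.trans_le (H.q_re t)).ne'
  -- For real `q` and `q'`, the product `(q + i s q'/q)(1 - i s q'/q²)` has imaginary part `s q'/q -
  -- s q'/q = 0`, so only the Taylor remainder contributes.
  have hdec : (q (levelCurve q s t) * levelVelocity q s t).im = (r * levelVelocity q s t).im := by
    have : q (levelCurve q s t) =
        r + (((q t).re : ℂ) + (s / (q t).re * (deriv q t).re : ℝ) * Complex.I) := by
      rw [hr, ← hq]
      push_cast
      rw [← hd]
      ring
    rw [this, add_mul, Complex.add_im, add_eq_left]
    simp only [levelVelocity, Complex.mul_im, Complex.add_re, Complex.add_im, Complex.ofReal_re,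
      Complex.ofReal_im, Complex.mul_re, Complex.I_re, Complex.I_im, Complex.one_re,
      Complex.one_im]
    field_simp
    ring
  rw [hdec]
  refine (Complex.abs_im_le_norm _).trans ?_
  rw [norm_mul]
  calc ‖r‖ * ‖levelVelocity q s t‖ ≤ (K * decayWeight τ t * s ^ 2) * 2 :=
        mul_le_mul hT (H.norm_levelVelocity_le hKs t) (norm_nonneg _)
          ((norm_nonneg _).trans hT)
    _ = _ := by ring

end LevelCurve

/-! ### Diagonalisation and energy growth along the level curve. -/

section Diagonal

variable {B p q α f g : ℂ → ℂ} {τ ρ K s k : ℝ} {U : Set ℂ}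

/-- The components of a solution in the basis of (unnormalised) eigenvectors satisfy a system that
is diagonal up to the derivative of `α`. -/
theorem PhaseBounds.hasDerivAt_diagonal (H : PhaseBounds p q α τ ρ K)
    (h : IsDiracPair B k U f g) (hU : horizontalStrip ρ ⊆ U)
    (hB : ∀ x ∈ horizontalStrip ρ, B x = k * p x) {x : ℂ} (hx : x ∈ horizontalStrip ρ) :
    HasDerivAt (fun x => f x + Complex.I * α x * g x)
      (-(Complex.I * k * q x) * (f x + Complex.I * α x * g x) + Complex.I * deriv α x * g x) x ∧
    HasDerivAt (fun x => Complex.I * α x * f x + g x)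
      (Complex.I * k * q x * (Complex.I * α x * f x + g x) + Complex.I * deriv α x * f x) x := by
  obtain ⟨hf, hg⟩ := h x (hU hx)
  rw [hB x hx] at hf hg
  have hα := (H.hasDerivAt_α hx).const_mul Complex.I
  have e1 := H.alpha_mul x hx
  have e2 := H.q_sq x hx
  -- Together with `p - α = α q`, which is `e1` rearranged, this is the eigenvector relation that
  -- removes the off-diagonal terms of order `k`.
  have e3 : α x * p x = q x - 1 := by
    refine mul_right_cancel₀ (H.one_add_ne x hx) ?_
    linear_combination p x * e1 - e2
  have hI := Complex.I_sq
  refine ⟨(hf.add (hα.mul hg)).congr_deriv ?_, ((hα.mul hf).add hg).congr_deriv ?_⟩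
  · linear_combination (-(Complex.I * k * f x)) * e3 - (k * g x) * e1 +
      (k * α x * g x * (1 + q x)) * hI
  · linear_combination (Complex.I * k * g x) * e3 + (k * f x) * e1 -
      (k * α x * f x * (1 + q x)) * hI

/-- The change of basis with rows `(1, ia)` and `(ia, 1)` has determinant `1 + a²`, so the
hypotheses bound its inverse. -/
theorem norm_le_of_diagonal {a u v : ℂ} {C : ℝ} (h : 1 / 2 ≤ ‖1 + a ^ 2‖) (ha : ‖a‖ ≤ C) :
    ‖u‖ ≤ 2 * (‖u + Complex.I * a * v‖ + C * ‖Complex.I * a * u + v‖) ∧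
    ‖v‖ ≤ 2 * (‖Complex.I * a * u + v‖ + C * ‖u + Complex.I * a * v‖) := by
  have hI := Complex.I_sq
  have key : ∀ z w y : ℂ, (1 + a ^ 2) * z = w - Complex.I * a * y →
      ‖z‖ ≤ 2 * (‖w‖ + C * ‖y‖) := by
    intro z w y hz
    have h1 : ‖1 + a ^ 2‖ * ‖z‖ ≤ ‖w‖ + C * ‖y‖ := by
      rw [← norm_mul, hz]
      refine (norm_sub_le _ _).trans ?_
      rw [norm_mul, norm_mul, Complex.norm_I, one_mul]
      gcongr
    have h2 := mul_le_mul_of_nonneg_right h (norm_nonneg z)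
    linarith
  constructor
  · refine key _ _ _ ?_
    linear_combination (a ^ 2 * u) * hI
  · refine key _ _ _ ?_
    linear_combination (a ^ 2 * v) * hI

/-- Growth of the energy of the diagonalised components along the level curve. -/
theorem PhaseBounds.energy_le (H : PhaseBounds p q α τ ρ K)
    (h : IsDiracPair B k U f g) (hU : horizontalStrip ρ ⊆ U)
    (hB : ∀ x ∈ horizontalStrip ρ, B x = k * p x) (hs : |s| < ρ) (hKs : K * |s| ≤ 1)
    {a b : ℝ} (hab : a ≤ b) {E : ℂ → ℝ}
    (hE : ∀ x, E x = ‖f x + Complex.I * α x * g x‖ ^ 2 + ‖Complex.I * α x * f x + g x‖ ^ 2) :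
    E (levelCurve q s b) ≤ E (levelCurve q s a) *
      Real.exp (2 * ((2 * |k| * K * s ^ 2 + 4 * (1 + K) * K) * ∫ t, decayWeight τ t)) := by
  -- The outer `2` comes from differentiating squared norms. The first summand is the phase error;
  -- the second comes from `α'`, with velocity at most `2` and `norm_le_of_diagonal` to recover `f`
  -- and `g`.
  set c := 2 * (2 * |k| * K * s ^ 2 + 4 * (1 + K) * K) with hc
  have hK := H.K_nonneg
  have hc0 : 0 ≤ c := by positivity
  have hmem := H.levelCurve_mem (q := q) hs
  set u : ℝ → ℂ := fun t => f (levelCurve q s t) +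
    Complex.I * α (levelCurve q s t) * g (levelCurve q s t)
  set v : ℝ → ℂ := fun t => Complex.I * α (levelCurve q s t) * f (levelCurve q s t) +
    g (levelCurve q s t)
  have hu := fun t => (H.hasDerivAt_diagonal h hU hB (hmem t)).1.scomp t (H.hasDerivAt_levelCurve s t)
  have hv := fun t => (H.hasDerivAt_diagonal h hU hB (hmem t)).2.scomp t (H.hasDerivAt_levelCurve s t)
  have hP : ∀ t, HasDerivAt (fun t => c * ∫ r in a..t, decayWeight τ r) (c * decayWeight τ t) t :=
    fun t => (intervalIntegral.integral_hasDerivAt_right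
      ((continuous_decayWeight τ).intervalIntegrable _ _)
      ((continuous_decayWeight τ).stronglyMeasurableAtFilter _ _)
      (continuous_decayWeight τ).continuousAt).const_mul c
  have := le_mul_exp_sub_of_hasDerivAt_le (E := fun t => ‖u t‖ ^ 2 + ‖v t‖ ^ 2) hab
    (fun t _ => (hasDerivAt_norm_sq (hu t)).add (hasDerivAt_norm_sq (hv t)))
    (fun t _ => hP t) ?_
  · rw [hE, hE]
    refine this.trans (mul_le_mul_of_nonneg_left (Real.exp_le_exp.2 ?_) (by positivity))
    rw [intervalIntegral.integral_same, mul_zero, sub_zero, ← mul_assoc]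
    exact mul_le_mul_of_nonneg_left (intervalIntegral_decayWeight_le H.tau_pos hab) hc0
  · intro t _
    simp only [Function.comp, smul_eq_mul]
    set x := levelCurve q s t with hx
    set x' := levelVelocity q s t with hx'
    have hu_def : f x + Complex.I * α x * g x = u t := rfl
    have hv_def : Complex.I * α x * f x + g x = v t := rfl
    rw [hu_def, hv_def]
    have hre : x.re = t := levelCurve_re t
    have hw := decayWeight_pos τ t
    have hw1 := decayWeight_le_one H.tau_pos t
    have hαK : ‖α x‖ ≤ K := (H.α_le x (hmem t)).trans
      (mul_le_of_le_one_right hK (decayWeight_le_one H.tau_pos _))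
    obtain ⟨hfb, hgb⟩ := norm_le_of_diagonal (u := f x) (v := g x) (H.half_le x (hmem t)) hαK
    rw [hu_def, hv_def] at hfb hgb
    have hα' := H.deriv_α x (hmem t)
    rw [hre] at hα'
    have him := H.abs_im_phase_le hs hKs t
    have hvel := H.norm_levelVelocity_le hKs t
    rw [← hx, ← hx'] at him
    rw [← hx'] at hvel
    -- A diagonal rate `iσq` changes the energy only through the imaginary part of `q x'`, the
    -- quantity that the curve makes small.
    have hdiag : ∀ (σ : ℝ) (z : ℂ), |σ| = |k| →
        (starRingEnd ℂ z * (x' * (Complex.I * σ * q x * z))).re ≤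
          |k| * (2 * K * s ^ 2 * decayWeight τ t) * ‖z‖ ^ 2 := by
      intro σ z hσ
      have e : starRingEnd ℂ z * (x' * (Complex.I * σ * q x * z)) =
          ((σ * ‖z‖ ^ 2 : ℝ) : ℂ) * (Complex.I * (q x * x')) := by
        have := Complex.conj_mul' z
        push_cast
        linear_combination (x' * Complex.I * σ * q x) * this
      rw [e, Complex.re_ofReal_mul, Complex.I_mul_re]
      calc σ * ‖z‖ ^ 2 * -(q x * x').im ≤ |σ * ‖z‖ ^ 2 * -(q x * x').im| := le_abs_self _
        _ = |k| * |(q x * x').im| * ‖z‖ ^ 2 := by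
            rw [abs_mul, abs_mul, hσ, abs_neg, abs_of_nonneg (sq_nonneg ‖z‖)]; ring
        _ ≤ _ := by gcongr
    have hoff : ∀ (z w : ℂ) (Y : ℝ), ‖w‖ ≤ Y →
        (starRingEnd ℂ z * (x' * (Complex.I * deriv α x * w))).re ≤
          2 * (K * decayWeight τ t) * (‖z‖ * Y) := by
      intro z w Y hY
      refine (Complex.re_le_norm _).trans ?_
      simp only [norm_mul, Complex.norm_conj, Complex.norm_I, one_mul]
      calc ‖z‖ * (‖x'‖ * (‖deriv α x‖ * ‖w‖))
          ≤ ‖z‖ * (2 * ((K * decayWeight τ t) * Y)) := by gcongr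
        _ = _ := by ring
    have d1 := hdiag (-k) (u t) (abs_neg k)
    have d2 := hdiag k (v t) rfl
    have o1 := hoff (u t) (g x) _ hgb
    have o2 := hoff (v t) (f x) _ hfb
    have split : ∀ z a b : ℂ, (starRingEnd ℂ z * (x' * (a + b))).re =
        (starRingEnd ℂ z * (x' * a)).re + (starRingEnd ℂ z * (x' * b)).re := fun z a b => by
      rw [mul_add, mul_add, Complex.add_re]
    rw [split (u t), split (v t)]
    rw [show -(Complex.I * k * q x) * u t = Complex.I * (-k : ℝ) * q x * u t by push_cast; ring]
    have hKw : 0 ≤ K * decayWeight τ t := by positivity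
    have hfin : 2 * (K * decayWeight τ t) * (‖u t‖ * (2 * (‖v t‖ + K * ‖u t‖))) +
        2 * (K * decayWeight τ t) * (‖v t‖ * (2 * (‖u t‖ + K * ‖v t‖))) ≤
        4 * (1 + K) * (K * decayWeight τ t) * (‖u t‖ ^ 2 + ‖v t‖ ^ 2) := by
      have := mul_le_mul_of_nonneg_left (two_mul_le_add_sq ‖u t‖ ‖v t‖)
        (mul_nonneg zero_le_four hKw)
      linarith
    have hgoal : c * decayWeight τ t * (‖u t‖ ^ 2 + ‖v t‖ ^ 2) =
        2 * (|k| * (2 * K * s ^ 2 * decayWeight τ t) * (‖u t‖ ^ 2 + ‖v t‖ ^ 2)) +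
        2 * (4 * (1 + K) * (K * decayWeight τ t) * (‖u t‖ ^ 2 + ‖v t‖ ^ 2)) := by
      rw [hc]; ring
    rw [hgoal]
    linarith

end Diagonal

/-! ### Comparison of the two ends of the level curve. -/

section CurveLimits

variable {B p q α f g : ℂ → ℂ} {τ ρ K s k : ℝ} {c d : ℂ}

theorem norm_eq_exp_mul_norm_rotate (k : ℝ) (f : ℂ → ℂ) (x : ℂ) :
    ‖f x‖ = Real.exp (k * x.im) * ‖rotate k f x‖ := by
  rw [rotate, norm_mul, norm_cexp_I_mul, ← mul_assoc, ← Real.exp_add, add_neg_cancel,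
    Real.exp_zero, one_mul]

/-- `q` tends to `1` at both ends, so the height `s / q` tends to `s`. -/
theorem PhaseBounds.tendsto_levelCurve_im (H : PhaseBounds p q α τ ρ K) {l : Filter ℝ}
    (hl : Tendsto (fun t : ℝ => |t|) l atTop) (s : ℝ) :
    Tendsto (fun t => (levelCurve q s t).im) l (𝓝 s) := by
  have hw : Tendsto (fun t => K * decayWeight τ t) l (𝓝 0) := by
    simpa using (tendsto_decayWeight_cobounded H.tau_pos hl).const_mul K
  have h1 : Tendsto (fun t : ℝ => (q t).re - 1) l (𝓝 0) := by
    refine squeeze_zero_norm (fun t => ?_) hw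
    have h2 := H.q_sub_one t (ofReal_mem_horizontalStrip H.rho_pos t)
    have h3 := Complex.abs_re_le_norm (q t - 1)
    rw [Complex.sub_re, Complex.one_re] at h3
    exact h3.trans h2
  have h2 : Tendsto (fun t : ℝ => (q t).re) l (𝓝 1) := by simpa using h1.add_const 1
  simp only [levelCurve_im]
  have h3 := (tendsto_const_nhds (x := s)).div h2 one_ne_zero
  rw [div_one] at h3
  exact h3

theorem PhaseBounds.tendsto_norm_levelCurve (H : PhaseBounds p q α τ ρ K) {l : Filter ℝ}
    (hl : Tendsto (fun t : ℝ => |t|) l atTop) (hs : |s| < ρ)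
    (hf : Tendsto (fun t => rotate k f (levelCurve q s t)) l (𝓝 c))
    (hg : Tendsto (fun t => rotate (-k) g (levelCurve q s t)) l (𝓝 d)) :
    Tendsto (fun t => ‖f (levelCurve q s t)‖) l (𝓝 (Real.exp (k * s) * ‖c‖)) ∧
    Tendsto (fun t => ‖g (levelCurve q s t)‖) l (𝓝 (Real.exp (-k * s) * ‖d‖)) ∧
    Tendsto (fun t => ‖α (levelCurve q s t)‖) l (𝓝 0) := by
  have him := H.tendsto_levelCurve_im hl s
  refine ⟨?_, ?_, ?_⟩
  · exact ((him.const_mul k).rexp.mul hf.norm).congr fun t =>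
      (norm_eq_exp_mul_norm_rotate k f _).symm
  · exact ((him.const_mul (-k)).rexp.mul hg.norm).congr fun t =>
      (norm_eq_exp_mul_norm_rotate (-k) g _).symm
  · have hw : Tendsto (fun t => K * decayWeight τ t) l (𝓝 0) := by
      simpa using (tendsto_decayWeight_cobounded H.tau_pos hl).const_mul K
    refine squeeze_zero (fun t => norm_nonneg _) (fun t => ?_) hw
    have := H.α_le _ (H.levelCurve_mem (q := q) hs t)
    rwa [levelCurve_re] at this

variable {ρ₀ θ₀ C τ₁ R C' τ₂ R' : ℝ} {a b : ℂ}

/-- As `α` vanishes at both ends, the energy tends to `e^{-2ks}` on the left, and on the right the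
first diagonal component has modulus tending to `e^{ks} |b|`. The energy bound between the ends
yields the exponent `-2ks` plus the growth term. -/
theorem PhaseBounds.norm_scatter_le (H : PhaseBounds p q α τ ρ K)
    (hR : RightDecay B ρ₀ θ₀ C τ₁ R) (hL : RightDecay (fun x => -B (-x)) ρ₀ θ₀ C' τ₂ R')
    (hρ : ρ ≤ ρ₀) (hB : ∀ x ∈ horizontalStrip ρ, B x = k * p x)
    (h : Scatters B k (sectorDomain ρ₀ θ₀) 0 1 b a) (hs : |s| < ρ) (hKs : K * |s| ≤ 1) :
    ‖b‖ ≤ Real.exp (-(2 * (k * s)) +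
      (2 * |k| * K * s ^ 2 + 4 * (1 + K) * K) * ∫ t, decayWeight τ t) := by
  obtain ⟨f, g, hp, hl, hr⟩ := h
  have hU : horizontalStrip ρ ⊆ sectorDomain ρ₀ θ₀ := horizontalStrip_subset_sectorDomain hρ
  have hmem : ∀ t, levelCurve q s t ∈ sectorDomain ρ₀ θ₀ := fun t => hU (H.levelCurve_mem hs t)
  have hcurve : ∀ {l l' : Filter ℝ}, Tendsto (fun t : ℝ => t) l l' →
      Tendsto (levelCurve q s) l
        ((comap Complex.re l' ⊓ 𝓟 (sectorDomain ρ₀ θ₀)) ⊓ 𝓟 {x | |x.im| ≤ |s|}) := by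
    intro l l' hll
    refine tendsto_inf.2 ⟨tendsto_inf.2 ⟨tendsto_comap_iff.2 ?_,
      tendsto_principal.2 (Eventually.of_forall hmem)⟩,
      tendsto_principal.2 (Eventually.of_forall fun t => H.abs_levelCurve_im_le s t)⟩
    simpa only [Function.comp_def, levelCurve_re] using hll
  have hright := hR.hasRealLimit_strip hp hr |s|
  have hleft := RightDecay.hasRealLimit_strip_left hL hp hl |s|
  obtain ⟨r1, r2, r3⟩ := H.tendsto_norm_levelCurve tendsto_abs_atTop_atTop hs
    (hright.1.comp (hcurve tendsto_id)) (hright.2.comp (hcurve tendsto_id))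
  obtain ⟨l1, l2, l3⟩ := H.tendsto_norm_levelCurve tendsto_abs_atBot_atTop hs
    (hleft.1.comp (hcurve tendsto_id)) (hleft.2.comp (hcurve tendsto_id))
  set Y := (2 * |k| * K * s ^ 2 + 4 * (1 + K) * K) * ∫ t, decayWeight τ t
  have hineq : ∀ t₁ t₂, t₁ ≤ t₂ →
      ‖f (levelCurve q s t₂)‖ - ‖α (levelCurve q s t₂)‖ * ‖g (levelCurve q s t₂)‖ ≤
        √(((‖f (levelCurve q s t₁)‖ + ‖α (levelCurve q s t₁)‖ * ‖g (levelCurve q s t₁)‖) ^ 2 +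
          (‖α (levelCurve q s t₁)‖ * ‖f (levelCurve q s t₁)‖ + ‖g (levelCurve q s t₁)‖) ^ 2) *
          Real.exp (2 * Y)) := by
    intro t₁ t₂ ht
    have hE := H.energy_le hp hU hB hs hKs ht (fun x => rfl)
    refine le_trans (b := ‖f (levelCurve q s t₂) +
        Complex.I * α (levelCurve q s t₂) * g (levelCurve q s t₂)‖) ?_ (Real.le_sqrt_of_sq_le ?_)
    · have := norm_sub_norm_le (f (levelCurve q s t₂))
        (-(Complex.I * α (levelCurve q s t₂) * g (levelCurve q s t₂)))
      rw [norm_neg, sub_neg_eq_add] at this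
      simpa only [norm_mul, Complex.norm_I, one_mul] using this
    · refine le_trans (le_add_of_nonneg_right (sq_nonneg _)) (hE.trans
        (mul_le_mul_of_nonneg_right (add_le_add ?_ ?_) (Real.exp_pos _).le))
      · refine pow_le_pow_left₀ (norm_nonneg _) ((norm_add_le _ _).trans_eq ?_) 2
        simp only [norm_mul, Complex.norm_I, one_mul]
      · refine pow_le_pow_left₀ (norm_nonneg _) ((norm_add_le _ _).trans_eq ?_) 2
        simp only [norm_mul, Complex.norm_I, one_mul]
  have hlimL := ((((l1.add (l3.mul l2)).pow 2).add (((l3.mul l1).add l2).pow 2)).mul_const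
    (Real.exp (2 * Y))).sqrt
  have hlimR := r1.sub (r3.mul r2)
  -- The left end goes to `-∞` with `t₂` fixed, and only then `t₂` goes to `+∞`.
  have hstep : ∀ t₂, _ ≤ _ := fun t₂ =>
    ge_of_tendsto hlimL ((eventually_le_atBot t₂).mono fun t₁ ht => hineq t₁ t₂ ht)
  have hfin := le_of_tendsto' hlimR hstep
  simp only [norm_zero, norm_one, mul_zero, zero_mul, zero_add, sub_zero, mul_one,
    zero_pow two_ne_zero] at hfin
  rw [← Real.exp_nat_mul, ← Real.exp_add,
    show ((2 : ℕ) : ℝ) * (-k * s) + 2 * Y = (2 : ℕ) * (-k * s + Y) by push_cast; ring,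
    Real.exp_nat_mul, Real.sqrt_sq (Real.exp_pos _).le] at hfin
  have : ‖b‖ = Real.exp (-(k * s)) * (Real.exp (k * s) * ‖b‖) := by
    rw [← mul_assoc, ← Real.exp_add, neg_add_cancel, Real.exp_zero, one_mul]
  rw [this]
  refine (mul_le_mul_of_nonneg_left hfin (Real.exp_pos _).le).trans_eq ?_
  rw [← Real.exp_add]
  ring_nf

end CurveLimits

/-! ### Choice of the shift and conclusion. -/

/-- Exponential smallness of the coefficient `b`, uniformly in `|lam| ≥ δ`. -/
theorem AssumptionA1.exists_norm_coeffB_le {A : ℝ → ℝ} {Aext : ℂ → ℂ} {ρ₀ θ₀ : ℝ}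
    (hA : AssumptionA1 A Aext ρ₀ θ₀) {δ : ℝ} (hδ : 0 < δ) :
    ∃ σ : ℝ, 0 < σ ∧ ∃ M : ℝ, 0 ≤ M ∧ ∀ ε : ℝ, 0 < ε → ∀ lam : ℝ, δ ≤ |lam| →
      ‖coeffB Aext (sectorDomain ρ₀ θ₀) ε lam‖ ≤ Real.exp (M - σ / ε) := by
  obtain ⟨τ, ρ, K, hρ, hH⟩ := hA.exists_phaseBounds hδ
  have H₀ := hH δ (le_abs_self δ)
  have hK := H₀.K_nonneg
  set W := ∫ t, decayWeight τ t
  have hW : 0 ≤ W := MeasureTheory.integral_nonneg fun t => (decayWeight_pos τ t).le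
  -- This ensures `K r ≤ 1` and `2 r K W ≤ 1`; the quadratic loss `2 |k| K W r²` is then at most
  -- `|k| r`, half of the gain `2 |k| r`.
  set r := min (ρ / 2) (1 / (2 * (K * W) + K + 1))
  have hρ0 := H₀.rho_pos
  have hr : 0 < r := lt_min (by linarith) (by positivity)
  have hrρ : r < ρ := (min_le_left _ _).trans_lt (by linarith)
  have hr' : r * (2 * (K * W) + K + 1) ≤ 1 := by
    have h1 : r ≤ 1 / (2 * (K * W) + K + 1) := min_le_right _ _
    rwa [le_div_iff₀ (by positivity)] at h1
  have hKW : 0 ≤ r * (K * W) := by positivity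
  have hrK : 0 ≤ r * K := by positivity
  refine ⟨δ * r, by positivity, 4 * (1 + K) * K * W, by positivity, fun ε hε lam hlam => ?_⟩
  have hlam0 : lam ≠ 0 := abs_pos.1 (hδ.trans_le hlam)
  have hε0 : (ε : ℂ) ≠ 0 := by exact_mod_cast hε.ne'
  have hlamC : (lam : ℂ) ≠ 0 := by exact_mod_cast hlam0
  obtain ⟨C, τ', R, hR, hL⟩ := hA.exists_rightDecay hε
  have hsc := scatters_coeff hR hL hA.analytic.differentiableOn hε.ne' lam
  -- The curve is shifted to the side where `k s = |k| r` is positive.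
  set s : ℝ := SignType.sign lam * r with hs
  have habs : |s| = r := by
    rw [hs, abs_mul, abs_of_pos hr]
    rcases lt_or_gt_of_ne hlam0 with h | h <;> simp [h]
  have hks : lam / ε * s = |lam| / ε * r := by
    have : lam * SignType.sign lam = |lam| := self_mul_sign lam
    rw [hs, ← this]
    ring
  have hkabs : |lam / ε| = |lam| / ε := by rw [abs_div, abs_of_pos hε]
  have := (hH lam hlam).norm_scatter_le (s := s) hR hL hρ (fun x _ => by
    push_cast; field_simp) hsc (by rw [habs]; exact hrρ) (by rw [habs]; nlinarith)
  refine this.trans (Real.exp_le_exp.2 ?_)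
  rw [hks, hkabs, ← sq_abs s, habs]
  have h1 : δ / ε ≤ |lam| / ε := by gcongr
  have h2 : 0 ≤ |lam| / ε := by positivity
  have h3 : |lam| / ε * r * (2 * (r * (K * W))) ≤ |lam| / ε * r :=
    mul_le_of_le_one_right (by positivity) (by linarith)
  have h4 : δ * r / ε ≤ |lam| / ε * r := by
    rw [show δ * r / ε = δ / ε * r by ring]
    exact mul_le_mul_of_nonneg_right h1 hr.le
  have e : (2 * (|lam| / ε) * K * r ^ 2 + 4 * (1 + K) * K) * W =
      |lam| / ε * r * (2 * (r * (K * W))) + 4 * (1 + K) * K * W := by ring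
  change -(2 * (|lam| / ε * r)) + (2 * (|lam| / ε) * K * r ^ 2 + 4 * (1 + K) * K) * W ≤ _
  rw [e]
  linarith

theorem AssumptionA1.norm_sq_coeff {A : ℝ → ℝ} {Aext : ℂ → ℂ} {ρ₀ θ₀ ε : ℝ}
    (hA : AssumptionA1 A Aext ρ₀ θ₀) (hε : 0 < ε) (lam : ℝ) :
    ‖coeffB Aext (sectorDomain ρ₀ θ₀) ε lam‖ ^ 2 +
      ‖coeffA Aext (sectorDomain ρ₀ θ₀) ε lam‖ ^ 2 = 1 := by
  obtain ⟨C, τ', R, hR, hL⟩ := hA.exists_rightDecay hε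
  have := (scatters_coeff hR hL hA.analytic.differentiableOn hε.ne' lam).norm_sq_eq
    (ofReal_mem_sectorDomain hA.rho_pos)
    (fun t => by simp [hA.extends_real, Complex.div_ofReal_im])
  simpa using this

theorem mainTheorem4 (A : ℝ → ℝ) (Aext : ℂ → ℂ) (ρ₀ θ₀ : ℝ)
    (hA : AssumptionA1 A Aext ρ₀ θ₀) :
    (∀ ε lam : ℝ, 0 < ε → lam ≠ 0 →
      ∃! T : Matrix (Fin 2) (Fin 2) ℂ,
        IsTransitionMatrix Aext (sectorDomain ρ₀ θ₀) ε lam T) ∧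
    ∀ δ : ℝ, 0 < δ →
      ∃ σ : ℝ, 0 < σ ∧ ∃ C ε₀ : ℝ, 0 < ε₀ ∧
        ∀ ε : ℝ, 0 < ε → ε < ε₀ → ∀ lam : ℝ, δ ≤ |lam| →
          coeffA Aext (sectorDomain ρ₀ θ₀) ε lam ≠ 0 ∧
          ‖reflectionCoeff Aext (sectorDomain ρ₀ θ₀) ε lam‖ ≤ C * Real.exp (-σ / ε) := by
  refine ⟨fun ε lam hε _ => ?_, fun δ hδ => ?_⟩
  · obtain ⟨C, τ', R, hR, hL⟩ := hA.exists_rightDecay hε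
    exact existsUnique_isTransitionMatrix hR hL hA.analytic.differentiableOn hε.ne' lam
  obtain ⟨σ, hσ, M, hM, hb⟩ := hA.exists_norm_coeffB_le hδ
  -- For `ε < σ / (M + 1)` the exponent `M - σ / ε` is at most `-1`, so `|b| ≤ e^{-1} ≤ 1/2` and
  -- conservation gives `|a| ≥ 1/2`. The factor `2` pays for the division by `a`.
  refine ⟨σ, hσ, 2 * Real.exp M, σ / (M + 1), by positivity, fun ε hε hε₀ lam hlam => ?_⟩
  have hbl := hb ε hε lam hlam
  have hsum := hA.norm_sq_coeff hε lam
  have hbhalf : ‖coeffB Aext (sectorDomain ρ₀ θ₀) ε lam‖ ≤ 1 / 2 := by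
    refine hbl.trans ?_
    have h1 : M + 1 ≤ σ / ε := by
      rw [lt_div_iff₀ (by linarith)] at hε₀
      rw [le_div_iff₀ hε]
      linarith
    calc Real.exp (M - σ / ε) ≤ Real.exp (-1) := Real.exp_le_exp.2 (by linarith)
      _ ≤ 1 / 2 := by
        rw [Real.exp_neg, ← one_div]
        exact one_div_le_one_div_of_le two_pos (by linarith [Real.add_one_le_exp (1 : ℝ)])
  have hahalf : 1 / 2 ≤ ‖coeffA Aext (sectorDomain ρ₀ θ₀) ε lam‖ := by
    nlinarith [norm_nonneg (coeffA Aext (sectorDomain ρ₀ θ₀) ε lam),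
      norm_nonneg (coeffB Aext (sectorDomain ρ₀ θ₀) ε lam)]
  refine ⟨norm_pos_iff.1 (by linarith), ?_⟩
  rw [reflectionCoeff, norm_div, div_le_iff₀ (by linarith)]
  have h2 : Real.exp (M - σ / ε) = Real.exp M * Real.exp (-σ / ε) := by
    rw [← Real.exp_add]; ring_nf
  rw [h2] at hbl
  have h3 := mul_le_mul_of_nonneg_left hahalf
    (by positivity : 0 ≤ 2 * Real.exp M * Real.exp (-σ / ε))
  linarith
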